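/- Let $G$ be a connected (finite-dimensional, Hausdorff, real) Lie group with Lie algebra $\mathfrak g$; compactness is not needed. Let $P = S^1\times G\to S^1$ be the trivial right principal $G$-bundle, let $\mathcal A$ be the space of smooth connections on $P$ (connection one-forms $A\in\Omega^1(P;\mathfrak g)$), and let $\mathcal LG$ be the group of smooth maps $S^1\to G$ under pointwise multiplication. Both $\mathcal A$ and $\mathcal LG$ carry the $C^\infty$ topology. A loop $g\in\mathcal LG$ acts on $P$ by the automorphism $(z,x)\mapsto(z,g(z)x)$, and hence on $\mathcal A$ from the right by pullback, $A\mapsto g^*A$. Let $\mathsf G=(\mathcal A\times\mathcal LG\rightrightarrows\mathcal A)$ with $s(A,g)=A$, $t(A,g)=g^*A$, and let $\mathsf H=(G\times G\rightrightarrows G)$ with $s(x,h)=x$, $t(x,h)=h^{-1}xh$, both with the composition of action groupoids. A morphism $\Psi:\mathsf K\to\mathsf L$ of topological groupoids (continuous maps $\Psi_0,\Psi_1$ on objects and arrows commuting with the structure maps) is called Morita if the square formed by $\Psi_1:\mathsf K_1\to\mathsf L_1$, $\Psi_0\times\Psi_0$ and the maps $(s,t)$ is cartesian in topological spaces and $s\circ\pi_2:\mathsf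 K_0\,{}_{\Psi_0}\!\times_t\mathsf L_1\to\mathsf L_0$ is an open surjection. Two topological groupoids are Morita equivalent if some topological groupoid has Morita morphisms to both. Then $\mathsf G$ and $\mathsf H$ are topological groupoids, and they are Morita equivalent. More precisely, every $A\in\mathcal A$ has a unique holonomy $\mathrm{hol}(A)\in G$, namely the element such that the horizontal lift of the loop $\theta\mapsto e^{i\theta}$, $0\le\theta\le 2\pi$, starting at $(1,1)\in P$ ends at $(1,\mathrm{hol}(A))$; and $A\mapsto\mathrm{hol}(A)$, $(A,g)\mapsto(\mathrm{hol}(A),g(1))$ is a Morita morphism $\mathsf G\to\mathsf H$. -/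

import Mathlib

open scoped Manifold ContDiff

noncomputable section

/-! ### Topological groupoids -/

universe u₀ u₁ v₀ v₁

/-- A small groupoid whose sets of objects and of arrows are topological spaces. The arrow `a` goes
from `s a` to `t a`, and `m a b` is defined when the target of `a` equals the source of `b`. -/
structure SpaceGroupoid where
  Obj : Type u₀
  Arr : Type u₁
  [topObj : TopologicalSpace Obj]
  [topArr : TopologicalSpace Arr]
  s : Arr → Obj
  t : Arr → Obj
  e : Obj → Arr
  i : Arr → Arr
  m : {p : Arr × Arr // t p.1 = s p.2} → Arr
  s_e : ∀ x, s (e x) = x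
  t_e : ∀ x, t (e x) = x
  s_i : ∀ a, s (i a) = t a
  t_i : ∀ a, t (i a) = s a
  s_m : ∀ p, s (m p) = s p.1.1
  t_m : ∀ p, t (m p) = t p.1.2
  e_m : ∀ a, m ⟨(e (s a), a), t_e (s a)⟩ = a
  m_e : ∀ a, m ⟨(a, e (t a)), (s_e (t a)).symm⟩ = a
  m_i : ∀ a, m ⟨(a, i a), (s_i a).symm⟩ = e (s a)
  i_m : ∀ a, m ⟨(i a, a), t_i a⟩ = e (t a)
  assoc : ∀ (a b c : Arr) (hab : t a = s b) (hbc : t b = s c),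
    m ⟨(m ⟨(a, b), hab⟩, c), (t_m ⟨(a, b), hab⟩).trans hbc⟩ =
      m ⟨(a, m ⟨(b, c), hbc⟩), hab.trans (s_m ⟨(b, c), hbc⟩).symm⟩

attribute [instance] SpaceGroupoid.topObj SpaceGroupoid.topArr

namespace SpaceGroupoid

/-- A topological groupoid: all structure maps are continuous. -/
structure IsTopological (K : SpaceGroupoid.{u₀, u₁}) : Prop where
  continuous_s : Continuous K.s
  continuous_t : Continuous K.t
  continuous_e : Continuous K.e
  continuous_i : Continuous K.i
  continuous_m : Continuous K.m

/-- A morphism of topological groupoids: a pair of continuous maps which commute with the structure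
maps. -/
structure Hom (K : SpaceGroupoid.{u₀, u₁}) (L : SpaceGroupoid.{v₀, v₁}) where
  obj : K.Obj → L.Obj
  arr : K.Arr → L.Arr
  continuous_obj : Continuous obj
  continuous_arr : Continuous arr
  map_s : ∀ a, L.s (arr a) = obj (K.s a)
  map_t : ∀ a, L.t (arr a) = obj (K.t a)
  map_e : ∀ x, arr (K.e x) = L.e (obj x)
  map_i : ∀ a, arr (K.i a) = L.i (arr a)
  map_m : ∀ p : {p : K.Arr × K.Arr // K.t p.1 = K.s p.2},
    arr (K.m p) = L.m ⟨(arr p.1.1, arr p.1.2),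
      (map_t p.1.1).trans ((congrArg obj p.2).trans (map_s p.1.2).symm)⟩

namespace Hom

variable {K : SpaceGroupoid.{u₀, u₁}} {L : SpaceGroupoid.{v₀, v₁}}

/-- The fibre product of `Ψ₀ × Ψ₀ : K₀ × K₀ → L₀ × L₀` and `(s, t) : L₁ → L₀ × L₀`. -/
abbrev ArrowPullback (Ψ : Hom K L) : Type _ :=
  {q : (K.Obj × K.Obj) × L.Arr // (Ψ.obj q.1.1, Ψ.obj q.1.2) = (L.s q.2, L.t q.2)}

/-- The canonical map from the arrows of `K` to the fibre product. -/
def toArrowPullback (Ψ : Hom K L) (a : K.Arr) : Ψ.ArrowPullback :=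
  ⟨((K.s a, K.t a), Ψ.arr a), by rw [Ψ.map_s, Ψ.map_t]⟩

/-- The fibre product `K₀ ×_{Ψ₀, t} L₁`. -/
abbrev TargetPullback (Ψ : Hom K L) : Type _ := {q : K.Obj × L.Arr // Ψ.obj q.1 = L.t q.2}

/-- A Morita morphism of topological groupoids: the square formed by `Ψ₁`, `Ψ₀ × Ψ₀` and the two
maps `(s, t)` is cartesian in topological spaces, and `s ∘ π₂ : K₀ ×_{Ψ₀, t} L₁ → L₀` is an open
surjection. -/
structure IsMorita (Ψ : Hom K L) : Prop where
  cartesian : IsHomeomorph Ψ.toArrowPullback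
  isOpenMap : IsOpenMap fun q : Ψ.TargetPullback => L.s q.1.2
  surjective : Function.Surjective fun q : Ψ.TargetPullback => L.s q.1.2

end Hom

/-- Two topological groupoids are Morita equivalent if a third topological groupoid has Morita
morphisms to both of them. -/
def MoritaEquivalent (K : SpaceGroupoid.{u₀, u₁}) (L : SpaceGroupoid.{v₀, v₁}) : Prop :=
  ∃ (M : SpaceGroupoid.{max u₀ v₀, max u₁ v₁}) (Φ : Hom M K) (Ψ : Hom M L),
    M.IsTopological ∧ Φ.IsMorita ∧ Ψ.IsMorita

end SpaceGroupoid

/-- The action groupoid `X × Γ ⇉ X` of a right action of a group: `s (x, g) = x`,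
`t (x, g) = x · g` and `m ((x, g), (x · g, h)) = (x, g h)`. -/
def rightActionGroupoid {X : Type u₀} {Γ : Type u₁} [TopologicalSpace X] [TopologicalSpace Γ]
    [Group Γ] (act : X → Γ → X) (act_one : ∀ x, act x 1 = x)
    (act_mul : ∀ x g h, act x (g * h) = act (act x g) h) : SpaceGroupoid where
  Obj := X
  Arr := X × Γ
  s a := a.1
  t a := act a.1 a.2
  e x := (x, 1)
  i a := (act a.1 a.2, a.2⁻¹)
  m p := (p.1.1.1, p.1.1.2 * p.1.2.2)
  s_e _ := rfl
  t_e := act_one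
  s_i _ := rfl
  t_i a := by rw [← act_mul, mul_inv_cancel, act_one]
  s_m _ := rfl
  t_m p := by rw [act_mul, p.2]
  e_m a := by simp
  m_e a := by simp
  m_i a := by simp
  i_m a := by simp
  assoc a b c hab hbc := by simp [mul_assoc]

/-- The groupoid `G × G ⇉ G` of the conjugation action, `s (x, h) = x`, `t (x, h) = h⁻¹ x h`. -/
def conjugationGroupoid (G : Type u₀) [TopologicalSpace G] [Group G] : SpaceGroupoid :=
  rightActionGroupoid (X := G) (Γ := G) (fun x h => h⁻¹ * x * h) (by simp)
    (by intro x g h; simp [mul_assoc])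

/-! ### The trivial principal bundle over the circle, its connections and its gauge group -/

section Bundle

variable {E : Type*} [NormedAddCommGroup E] [NormedSpace ℝ E]
  {H : Type*} [TopologicalSpace H] (I : ModelWithCorners ℝ E H)
  (G : Type*) [TopologicalSpace G] [ChartedSpace H G] [Group G]

/-- The adjoint action of `g` on the Lie algebra: the derivative at `1` of `x ↦ g x g⁻¹`. -/
def lieAd {G : Type*} [TopologicalSpace G] [ChartedSpace H G] [Group G] (g : G)
    (X : GroupLieAlgebra I G) : GroupLieAlgebra I G :=
  mfderiv I I (fun x : G => g * x * g⁻¹) 1 X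

variable [LieGroup I ∞ G]

/-- A connection on the trivial right principal bundle `P = Circle × G → Circle`, as a `𝔤`-valued
one-form `A` on the total space: it is smooth (as a function on the tangent bundle of `P`), it
returns `X` on the fundamental vector field of `X ∈ 𝔤`, and `R_g^* A = Ad(g⁻¹) A` for the right
translation `R_g` by `g`. -/
structure CircleConnection where
  form : ∀ p : Circle × G, TangentSpace ((𝓡 1).prod I) p →L[ℝ] GroupLieAlgebra I G
  smooth : ContMDiff (M' := E) ((𝓡 1).prod I).tangent 𝓘(ℝ, E) ∞
    (fun v : TangentBundle ((𝓡 1).prod I) (Circle × G) => form v.1 v.2)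
  vertical : ∀ (p : Circle × G) (X : GroupLieAlgebra I G),
    form (p.1, p.2 * 1) (mfderiv I ((𝓡 1).prod I) (fun x : G => (p.1, p.2 * x)) 1 X) = X
  equivariant : ∀ (g : G) (p : Circle × G) (v : TangentSpace ((𝓡 1).prod I) p),
    form (p.1, p.2 * g)
        (mfderiv ((𝓡 1).prod I) ((𝓡 1).prod I) (fun q : Circle × G => (q.1, q.2 * g)) p v) =
      lieAd I g⁻¹ (form p v)

/-- The loop group of `G`: smooth maps from the circle to `G` with the pointwise product. -/
abbrev SmoothLoop : Type _ := C^∞⟮𝓡 1, Circle; I, G⟯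

variable {I G}

/-- The automorphism `(z, x) ↦ (z, g(z) x)` of the trivial bundle given by a loop `g`. -/
def SmoothLoop.gauge (g : SmoothLoop I G) (p : Circle × G) : Circle × G := (p.1, g p.1 * p.2)

theorem SmoothLoop.contMDiff_gauge (g : SmoothLoop I G) :
    ContMDiff ((𝓡 1).prod I) ((𝓡 1).prod I) ∞ g.gauge :=
  contMDiff_fst.prodMk ((g.contMDiff.comp contMDiff_fst).mul contMDiff_snd)

namespace CircleConnection

@[ext]
theorem ext {A B : CircleConnection I G} (h : ∀ p, A.form p = B.form p) : A = B := by
  cases A; cases B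
  congr
  exact funext h

/-- The pullback `g^* A` of a connection along the bundle automorphism given by a loop. -/
def pullback (A : CircleConnection I G) (g : SmoothLoop I G) : CircleConnection I G where
  form p := (A.form (g.gauge p)).comp (mfderiv ((𝓡 1).prod I) ((𝓡 1).prod I) g.gauge p)
  smooth := A.smooth.comp (g.contMDiff_gauge.contMDiff_tangentMap (m := ∞) le_rfl)
  vertical p X := by
    have hR : ContMDiff I ((𝓡 1).prod I) ∞ (fun x : G => (p.1, p.2 * x)) :=
      contMDiff_const.prodMk (contMDiff_const.mul contMDiff_id)
    have key : ∀ f : G → Circle × G, f = (fun x : G => (p.1, (g p.1 * p.2) * x)) →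
        A.form (f 1) (mfderiv I ((𝓡 1).prod I) f 1 X) = X := by
      rintro f rfl
      exact A.vertical (p.1, g p.1 * p.2) X
    have h := key (g.gauge ∘ fun x : G => (p.1, p.2 * x))
      (by funext x; simp [SmoothLoop.gauge, mul_assoc])
    rw [mfderiv_comp (I' := (𝓡 1).prod I) 1
      (g.contMDiff_gauge.mdifferentiableAt (by simp)) (hR.mdifferentiableAt (by simp))] at h
    exact h
  equivariant h p v := by
    have hR : ContMDiff ((𝓡 1).prod I) ((𝓡 1).prod I) ∞
        (fun q : Circle × G => (q.1, q.2 * h)) :=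
      contMDiff_fst.prodMk (contMDiff_snd.mul contMDiff_const)
    have hg := g.contMDiff_gauge
    have key : ∀ f : Circle × G → Circle × G,
        f = (fun q : Circle × G => (q.1, q.2 * h)) ∘ g.gauge →
        A.form (f p) (mfderiv ((𝓡 1).prod I) ((𝓡 1).prod I) f p v) =
          lieAd I h⁻¹ (A.form (g.gauge p)
            (mfderiv ((𝓡 1).prod I) ((𝓡 1).prod I) g.gauge p v)) := by
      rintro f rfl
      rw [mfderiv_comp (I' := (𝓡 1).prod I) p (hR.mdifferentiableAt (by simp))
        (hg.mdifferentiableAt (by simp))]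
      exact A.equivariant h (g.gauge p) _
    have h' := key (g.gauge ∘ fun q : Circle × G => (q.1, q.2 * h))
      (by funext q; simp [SmoothLoop.gauge, mul_assoc])
    rw [mfderiv_comp (I' := (𝓡 1).prod I) p (hg.mdifferentiableAt (by simp))
      (hR.mdifferentiableAt (by simp))] at h'
    exact h'

theorem pullback_one (A : CircleConnection I G) : A.pullback 1 = A := by
  have h1 : (1 : SmoothLoop I G).gauge = id := by
    funext p; simp [SmoothLoop.gauge]
  have key : ∀ (f : Circle × G → Circle × G) (p : Circle × G), f = id →
      ∀ v, A.form (f p) (mfderiv ((𝓡 1).prod I) ((𝓡 1).prod I) f p v) = A.form p v := by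
    rintro f p rfl v
    rw [mfderiv_id]
    rfl
  ext p v
  exact key _ p h1 v

theorem pullback_mul (A : CircleConnection I G) (g h : SmoothLoop I G) :
    A.pullback (g * h) = (A.pullback g).pullback h := by
  have hgh : (g * h).gauge = g.gauge ∘ h.gauge := by
    funext p; simp [SmoothLoop.gauge, mul_assoc]
  have key : ∀ (f : Circle × G → Circle × G) (p : Circle × G), f = g.gauge ∘ h.gauge →
      ∀ v, A.form (f p) (mfderiv ((𝓡 1).prod I) ((𝓡 1).prod I) f p v) =
        ((A.pullback g).pullback h).form p v := by
    rintro f p rfl v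
    rw [mfderiv_comp (I' := (𝓡 1).prod I) p (g.contMDiff_gauge.mdifferentiableAt (by simp))
      (h.contMDiff_gauge.mdifferentiableAt (by simp))]
    rfl
  ext p v
  exact key _ p hgh v

end CircleConnection

/-! ### The topologies -/

/-- The topology induced by a family of curves in a normed space, for the uniform convergence of
the curves and of all their derivatives. -/
abbrev smoothCurveTopology {X : Type*} {V : Type*} [NormedAddCommGroup V] [NormedSpace ℝ V]
    (a : X → ℝ → V) : TopologicalSpace X :=
  ⨅ k : ℕ, TopologicalSpace.induced (fun x => UniformFun.ofFun (iteratedDeriv k (a x)))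
    (inferInstance : TopologicalSpace (UniformFun ℝ V))

/-- The coefficient of the local expression of a connection: with the section `σ(z) = (z, 1)` of
the trivial bundle and the coordinate `θ ↦ exp(iθ)` of the circle, `σ^* A = coeff A dθ`. -/
def CircleConnection.coeff (A : CircleConnection I G) (θ : ℝ) : E :=
  A.form (Circle.exp θ, 1)
    (mfderiv 𝓘(ℝ, ℝ) ((𝓡 1).prod I) (fun τ : ℝ => (Circle.exp τ, (1 : G))) θ (1 : ℝ))

/-- The `C^∞` topology on the space of connections: uniform convergence of the local expression
`σ^* A`, a smooth `𝔤`-valued one-form on the circle, with all its derivatives. -/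
instance : TopologicalSpace (CircleConnection I G) :=
  smoothCurveTopology CircleConnection.coeff

/-- The left logarithmic derivative `g⁻¹ dg/dθ` of a loop, as a curve in the Lie algebra. -/
def SmoothLoop.logDeriv (g : SmoothLoop I G) (θ : ℝ) : E :=
  mfderiv 𝓘(ℝ, ℝ) I (fun τ : ℝ => (g (Circle.exp θ))⁻¹ * g (Circle.exp τ)) θ (1 : ℝ)

/-- The `C^∞` topology on the loop group: uniform convergence of loops with all their derivatives,
where the derivatives are read in the left trivialisation `TG = G × 𝔤` of the tangent bundle, in
which the velocity of `g` is `(g, g⁻¹ dg/dθ)`. -/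
instance : TopologicalSpace (SmoothLoop I G) :=
  TopologicalSpace.induced (fun g => (g : C(Circle, G))) ContinuousMap.compactOpen ⊓
    smoothCurveTopology SmoothLoop.logDeriv

variable (I G) in
/-- The action groupoid `𝒜 × LG ⇉ 𝒜` with `s (A, g) = A` and `t (A, g) = g^* A`. -/
def connectionGroupoid : SpaceGroupoid :=
  rightActionGroupoid (X := CircleConnection I G) (Γ := SmoothLoop I G)
    CircleConnection.pullback CircleConnection.pullback_one CircleConnection.pullback_mul

/-! ### Holonomy -/

/-- `x` is the holonomy of `A` around the circle, from the base point `(1, 1)` of the bundle: there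
is a horizontal lift `θ ↦ (exp(iθ), u θ)` of the loop which starts at `(1, 1)` and ends, after one
turn, at `(1, x)`. -/
def CircleConnection.HasHolonomy (A : CircleConnection I G) (x : G) : Prop :=
  ∃ u : ℝ → G, ContMDiff 𝓘(ℝ, ℝ) I ∞ u ∧ u 0 = 1 ∧ u (2 * Real.pi) = x ∧
    ∀ θ : ℝ, A.form (Circle.exp θ, u θ)
      (mfderiv 𝓘(ℝ, ℝ) ((𝓡 1).prod I) (fun τ : ℝ => (Circle.exp τ, u τ)) θ (1 : ℝ)) = 0

end Bundle

end

/-!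
The pullback of a connection `A` along the section `z ↦ (z, 1)` is `a dθ` for a smooth
`2π`-periodic curve `a` in the Lie algebra, and `A ↦ a` is a bijection. A lift `(exp(iθ), u θ)` is
horizontal if and only if the inverse `γ` of `u` has the left logarithmic derivative `a`, which
determines `γ` by its value at `0`. So `A` has exactly one holonomy `hol A = γ(2π)⁻¹`, where
`γ 0 = 1`. Since `γ` becomes `g(1)⁻¹ γ g` for the connection `g^* A`, gauge transformations act on
holonomies by conjugation with `g(1)`. Three facts make this a Morita morphism.

* Cartesian square. If `hol B = h⁻¹ hol(A) h`, then `γ_A⁻¹ h γ_B` is `2π`-periodic, and it is the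
  only gauge transformation from `A` to `B` with value `h` at `1`. It depends continuously on
  `(A, B, h)`: for the `C⁰` topology this is the continuous dependence of the solutions of the
  logarithmic derivative equation on `a`, and for the `C^∞` topology it follows by bootstrap,
  since the logarithmic derivative of the gauge transformation is an expression in the
  transformation itself.
* Openness. Multiplying `γ` on the left by a curve which moves from `1` to `x` in the interior of
  the period multiplies the holonomy by `x⁻¹` and changes `a` only there. For `x` near `1` the
  curve can be chosen to depend smoothly on `x`, so every neighbourhood of `A` is mapped onto a
  neighbourhood of `hol A`.
* Surjectivity. By the same deformation the image of the holonomy is open and closed.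
-/

open Topology Filter Set

noncomputable section

/-! ### Lie groups in the chart at the identity -/

section UnitChart

variable {E : Type*} [NormedAddCommGroup E] [NormedSpace ℝ E]
  {H : Type*} [TopologicalSpace H] (I : ModelWithCorners ℝ E H)
  (G : Type*) [TopologicalSpace G] [ChartedSpace H G] [Group G]

/-- The preferred chart of a Lie group at the identity, through which the group is compared with the
model space of its Lie algebra. -/
def unitChart : PartialEquiv G E := extChartAt I (1 : G)

/-- The coordinates of the identity in `unitChart`; they need not vanish. -/
def unitCoord : E := unitChart I G 1

@[simp]
theorem unitChart_one : unitChart I G 1 = unitCoord I G := rfl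

theorem tendsto_unitChart : Tendsto (unitChart I G) (𝓝 1) (𝓝 (unitCoord I G)) :=
  continuousAt_extChartAt 1

@[simp]
theorem one_mem_unitChart_source : (1 : G) ∈ (unitChart I G).source := mem_extChartAt_source _

@[simp]
theorem unitChart_symm_unitCoord : (unitChart I G).symm (unitCoord I G) = 1 :=
  (unitChart I G).left_inv (one_mem_unitChart_source I G)

theorem unitCoord_mem_target : unitCoord I G ∈ (unitChart I G).target :=
  (unitChart I G).map_source (one_mem_unitChart_source I G)

theorem isOpen_unitChart_source : IsOpen (unitChart I G).source := isOpen_extChartAt_source _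

variable {G} in
theorem eventually_mem_unitChart_source {α : Type*} [TopologicalSpace α] {f : α → G} {a : α}
    (hf : ContinuousAt f a) (ha : f a = 1) : ∀ᶠ x in 𝓝 a, f x ∈ (unitChart I G).source :=
  hf.eventually_mem ((isOpen_unitChart_source I G).mem_nhds (by simp [ha]))

variable {G} in
theorem eventually_unitChart_symm_apply {α : Type*} [TopologicalSpace α] {f : α → G} {a : α}
    (hf : ContinuousAt f a) (ha : f a = 1) :
    ∀ᶠ x in 𝓝 a, (unitChart I G).symm (unitChart I G (f x)) = f x :=
  (eventually_mem_unitChart_source I hf ha).mono fun _ => (unitChart I G).left_inv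

variable {I G} in
theorem hasDerivAt_comp_of_unitChart {V : Type*} [NormedAddCommGroup V] [NormedSpace ℝ V]
    {f : G → V} {D : E →L[ℝ] V} {x : ℝ → G} {ξ : E} {θ : ℝ} (hxθ : x θ = 1)
    (hf : HasFDerivAt (fun y => f ((unitChart I G).symm y)) D (unitCoord I G))
    (hc : ContinuousAt x θ) (hx : HasDerivAt (fun τ => unitChart I G (x τ)) ξ θ) :
    HasDerivAt (fun τ => f (x τ)) (D ξ) θ := by
  refine (HasFDerivAt.comp_hasDerivAt θ (by simpa [hxθ] using hf) hx).congr_of_eventuallyEq ?_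
  filter_upwards [eventually_unitChart_symm_apply I hc hxθ] with τ hτ
  simp [hτ]

section Boundaryless

variable [I.Boundaryless]

theorem isOpen_unitChart_target : IsOpen (unitChart I G).target := isOpen_extChartAt_target _

theorem unitChart_target_mem_nhds : (unitChart I G).target ∈ 𝓝 (unitCoord I G) :=
  extChartAt_target_mem_nhds _

theorem eventually_unitChart_apply_symm :
    ∀ᶠ y in 𝓝 (unitCoord I G), unitChart I G ((unitChart I G).symm y) = y :=
  (eventually_mem_set.2 (unitChart_target_mem_nhds I G)).mono fun _ => (unitChart I G).right_inv

variable {I G}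

theorem mfderiv_one_eq_fderiv_unitChart {f : G → G} (hf : MDifferentiableAt I I f 1)
    (h1 : f 1 = 1) :
    (mfderiv I I f 1 : E →L[ℝ] E) =
      fderiv ℝ (fun z => unitChart I G (f ((unitChart I G).symm z))) (unitCoord I G) := by
  have h : mfderiv I I f 1 = (fderivWithin ℝ (writtenInExtChartAt I I 1 f) (range I)
    (unitCoord I G) : E →L[ℝ] E) := hf.mfderiv
  rw [h, I.range_eq_univ, fderivWithin_univ]
  simp only [writtenInExtChartAt, h1]
  rfl

end Boundaryless

variable {I G} [LieGroup I ∞ G]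

theorem contMDiffAt_unitChart {x : G} (hx : x ∈ (unitChart I G).source) :
    ContMDiffAt I 𝓘(ℝ, E) ∞ (unitChart I G) x :=
  contMDiffAt_extChartAt' (by rwa [unitChart, extChartAt_source] at hx)

theorem contDiffAt_unitChart_comp {V : Type*} [NormedAddCommGroup V] [NormedSpace ℝ V]
    {f : V → G} {v : V} (hf : ContMDiffAt 𝓘(ℝ, V) I ∞ f v) (hv : f v ∈ (unitChart I G).source) :
    ContDiffAt ℝ ∞ (fun w => unitChart I G (f w)) v :=
  ((contMDiffAt_unitChart hv).comp v hf).contDiffAt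

theorem contMDiff_conj (g : G) : ContMDiff I I ∞ (fun x : G => g * x * g⁻¹) :=
  (contMDiff_const.mul contMDiff_id).mul contMDiff_const

variable [I.Boundaryless]

theorem contMDiffAt_unitChart_symm {y : E} (hy : y ∈ (unitChart I G).target) :
    ContMDiffAt 𝓘(ℝ, E) I ∞ (unitChart I G).symm y :=
  (contMDiffOn_extChartAt_symm (1 : G) y hy).contMDiffAt ((isOpen_unitChart_target I G).mem_nhds hy)

theorem contMDiffAt_unitChart_symm_fst {y z : E} (hy : y ∈ (unitChart I G).target) :
    ContMDiffAt 𝓘(ℝ, E × E) I ∞ (fun p : E × E => (unitChart I G).symm p.1) (y, z) :=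
  ContMDiffAt.comp (y, z) (g := (unitChart I G).symm) (f := Prod.fst)
    (contMDiffAt_unitChart_symm hy) contDiff_fst.contMDiff.contMDiffAt

theorem contMDiffAt_unitChart_symm_snd {y z : E} (hz : z ∈ (unitChart I G).target) :
    ContMDiffAt 𝓘(ℝ, E × E) I ∞ (fun p : E × E => (unitChart I G).symm p.2) (y, z) :=
  ContMDiffAt.comp (y, z) (g := (unitChart I G).symm) (f := Prod.snd)
    (contMDiffAt_unitChart_symm hz) contDiff_snd.contMDiff.contMDiffAt

theorem contDiffAt_chartMul {y z : E} (hy : y ∈ (unitChart I G).target)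
    (hz : z ∈ (unitChart I G).target)
    (h : (unitChart I G).symm y * (unitChart I G).symm z ∈ (unitChart I G).source) :
    ContDiffAt ℝ ∞ (fun p : E × E =>
      unitChart I G ((unitChart I G).symm p.1 * (unitChart I G).symm p.2)) (y, z) :=
  contDiffAt_unitChart_comp
    ((contMDiffAt_unitChart_symm_fst hy).mul (contMDiffAt_unitChart_symm_snd hz)) h

theorem contDiffAt_chartLeftDiv {y z : E} (hy : y ∈ (unitChart I G).target)
    (hz : z ∈ (unitChart I G).target)
    (h : ((unitChart I G).symm y)⁻¹ * (unitChart I G).symm z ∈ (unitChart I G).source) :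
    ContDiffAt ℝ ∞ (fun p : E × E =>
      unitChart I G (((unitChart I G).symm p.1)⁻¹ * (unitChart I G).symm p.2)) (y, z) :=
  contDiffAt_unitChart_comp
    ((contMDiffAt_unitChart_symm_fst hy).inv.mul (contMDiffAt_unitChart_symm_snd hz)) h

theorem hasFDerivAt_chartMul :
    HasFDerivAt (fun p : E × E =>
      unitChart I G ((unitChart I G).symm p.1 * (unitChart I G).symm p.2))
      (ContinuousLinearMap.fst ℝ E E + ContinuousLinearMap.snd ℝ E E)
      (unitCoord I G, unitCoord I G) := by
  have hmul := ((contDiffAt_chartMul (I := I) (G := G) (unitCoord_mem_target I G)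
    (unitCoord_mem_target I G) (by simp)).differentiableAt (by simp)).hasFDerivAt
  set D := fderiv ℝ (fun p : E × E =>
    unitChart I G ((unitChart I G).symm p.1 * (unitChart I G).symm p.2))
    (unitCoord I G, unitCoord I G)
  have hleft : D.comp (ContinuousLinearMap.inl ℝ E E) = ContinuousLinearMap.id ℝ E := by
    refine (HasFDerivAt.comp (unitCoord I G) hmul (f := fun y => (y, unitCoord I G))
      (hasFDerivAt_prodMk_left (𝕜 := ℝ) (unitCoord I G) (unitCoord I G))).unique
      ((hasFDerivAt_id _).congr_of_eventuallyEq ?_)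
    filter_upwards [eventually_unitChart_apply_symm I G] with y hy
    simp [hy]
  have hright : D.comp (ContinuousLinearMap.inr ℝ E E) = ContinuousLinearMap.id ℝ E := by
    refine (HasFDerivAt.comp (unitCoord I G) hmul
      (hasFDerivAt_prodMk_right (𝕜 := ℝ) (unitCoord I G) (unitCoord I G))).unique
      ((hasFDerivAt_id _).congr_of_eventuallyEq ?_)
    filter_upwards [eventually_unitChart_apply_symm I G] with y hy
    simp [hy]
  have hD : D = ContinuousLinearMap.fst ℝ E E + ContinuousLinearMap.snd ℝ E E := by
    refine ContinuousLinearMap.prod_ext ?_ ?_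
    · rw [hleft]; ext v; simp
    · rw [hright]; ext v; simp
  rwa [hD] at hmul

theorem continuousAt_unitChart_symm_inv :
    ContinuousAt (fun y : E => ((unitChart I G).symm y)⁻¹) (unitCoord I G) :=
  (contMDiffAt_unitChart_symm (unitCoord_mem_target I G)).inv.continuousAt

theorem hasFDerivAt_chartInv :
    HasFDerivAt (fun y : E => unitChart I G (((unitChart I G).symm y)⁻¹))
      (-ContinuousLinearMap.id ℝ E) (unitCoord I G) := by
  have hinv := ((contDiffAt_unitChart_comp
    (contMDiffAt_unitChart_symm (unitCoord_mem_target I G)).inv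
      (by simp)).differentiableAt (by simp)).hasFDerivAt
  set D := fderiv ℝ (fun y : E => unitChart I G (((unitChart I G).symm y)⁻¹)) (unitCoord I G)
  have hmul := HasFDerivAt.comp (unitCoord I G)
    (by simpa using hasFDerivAt_chartMul (I := I) (G := G))
    ((hasFDerivAt_id (unitCoord I G)).prodMk hinv)
  have hconst := hmul.unique
    ((hasFDerivAt_const (unitCoord I G) (unitCoord I G)).congr_of_eventuallyEq (by
      filter_upwards [eventually_unitChart_symm_apply I
        (continuousAt_unitChart_symm_inv (I := I) (G := G)) (by simp)] with y hy
      simp [hy]))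
  have hD : D = -ContinuousLinearMap.id ℝ E := by
    ext v
    simpa using eq_neg_of_add_eq_zero_right (DFunLike.congr_fun hconst v)
  rwa [hD] at hinv

end UnitChart

section Adjoint

variable {E : Type*} [NormedAddCommGroup E] [NormedSpace ℝ E]
  {H : Type*} [TopologicalSpace H] (I : ModelWithCorners ℝ E H)
  {G : Type*} [TopologicalSpace G] [ChartedSpace H G] [Group G]

/-- The adjoint action `lieAd` of a group element, as a continuous linear map of the model space
`E`, to which the Lie algebra is definitionally equal. -/
def adjointCLM (g : G) : E →L[ℝ] E := mfderiv I I (fun x : G => g * x * g⁻¹) 1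

variable (G) in
/-- The derivative `ad` of the adjoint action `Ad` at the identity. -/
def adjointDeriv : E →L[ℝ] E →L[ℝ] E :=
  fderiv ℝ (fun y => adjointCLM I ((unitChart I G).symm y)) (unitCoord I G)

variable {I} [LieGroup I ∞ G] [I.Boundaryless]

theorem hasFDerivAt_chartConj (g : G) :
    HasFDerivAt (fun y : E => unitChart I G (g * (unitChart I G).symm y * g⁻¹))
      (adjointCLM I g) (unitCoord I G) := by
  rw [adjointCLM, mfderiv_one_eq_fderiv_unitChart
    ((contMDiff_conj g).mdifferentiableAt (by simp)) (by simp)]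
  exact ((contDiffAt_unitChart_comp ((contMDiff_conj g).contMDiffAt.comp _
    (contMDiffAt_unitChart_symm (unitCoord_mem_target I G))) (by simp)).differentiableAt
      (by simp)).hasFDerivAt

theorem adjointCLM_one : adjointCLM I (1 : G) = ContinuousLinearMap.id ℝ E := by
  refine (hasFDerivAt_chartConj (1 : G)).unique ((hasFDerivAt_id _).congr_of_eventuallyEq ?_)
  filter_upwards [eventually_unitChart_apply_symm I G] with y hy
  simp [hy]

theorem adjointCLM_mul (g h : G) :
    adjointCLM I (g * h) = (adjointCLM I g).comp (adjointCLM I h) := by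
  have hcomp := HasFDerivAt.comp (unitCoord I G) (by simpa using hasFDerivAt_chartConj g)
    (hasFDerivAt_chartConj (I := I) h)
  refine (hasFDerivAt_chartConj (g * h)).unique (hcomp.congr_of_eventuallyEq ?_)
  have hcont : ContinuousAt (fun y => h * (unitChart I G).symm y * h⁻¹) (unitCoord I G) :=
    ((contMDiff_conj h).contMDiffAt.comp _
      (contMDiffAt_unitChart_symm (unitCoord_mem_target I G))).continuousAt
  filter_upwards [eventually_unitChart_symm_apply I hcont (by simp)] with y hy
  simp only [Function.comp_apply, hy]
  simp [mul_assoc]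

theorem adjointCLM_inv_apply_apply (g : G) (ξ : E) : adjointCLM I g⁻¹ (adjointCLM I g ξ) = ξ := by
  rw [← ContinuousLinearMap.comp_apply, ← adjointCLM_mul, inv_mul_cancel, adjointCLM_one,
    ContinuousLinearMap.id_apply]

theorem adjointCLM_apply_inv_apply (g : G) (ξ : E) : adjointCLM I g (adjointCLM I g⁻¹ ξ) = ξ := by
  simpa using adjointCLM_inv_apply_apply (I := I) g⁻¹ ξ

theorem contDiffAt_adjointCLM_unitChart_symm :
    ContDiffAt ℝ ∞ (fun y => adjointCLM I ((unitChart I G).symm y)) (unitCoord I G) := by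
  have hconj : ContDiffAt ℝ ∞ (fun p : E × E => unitChart I G ((unitChart I G).symm p.1 *
      (unitChart I G).symm p.2 * ((unitChart I G).symm p.1)⁻¹)) (unitCoord I G, unitCoord I G) :=
    contDiffAt_unitChart_comp (((contMDiffAt_unitChart_symm_fst (unitCoord_mem_target I G)).mul
      (contMDiffAt_unitChart_symm_snd (unitCoord_mem_target I G))).mul
      (contMDiffAt_unitChart_symm_fst (unitCoord_mem_target I G)).inv) (by simp)
  have hderiv := ContDiffAt.fderiv (m := ∞) (x₀ := unitCoord I G) (g := fun _ => unitCoord I G)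
    (f := fun y z => unitChart I G ((unitChart I G).symm y *
      (unitChart I G).symm z * ((unitChart I G).symm y)⁻¹)) hconj contDiffAt_const (by simp)
  exact hderiv.congr_of_eventuallyEq (Eventually.of_forall fun y =>
    (hasFDerivAt_chartConj ((unitChart I G).symm y)).fderiv.symm)

theorem hasFDerivAt_adjointCLM_unitChart_symm :
    HasFDerivAt (fun y => adjointCLM I ((unitChart I G).symm y)) (adjointDeriv I G)
      (unitCoord I G) :=
  (contDiffAt_adjointCLM_unitChart_symm.differentiableAt (by simp)).hasFDerivAt

theorem contMDiff_adjointCLM :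
    ContMDiff I 𝓘(ℝ, E →L[ℝ] E) ∞ (fun g : G => adjointCLM I g) := by
  have hone : ContMDiffAt I 𝓘(ℝ, E →L[ℝ] E) ∞ (fun g : G => adjointCLM I g) 1 := by
    refine (ContMDiffAt.comp (1 : G) contDiffAt_adjointCLM_unitChart_symm.contMDiffAt
      (contMDiffAt_unitChart (one_mem_unitChart_source I G))).congr_of_eventuallyEq ?_
    filter_upwards [eventually_unitChart_symm_apply (G := G) I continuousAt_id rfl] with x hx
    simpa using congrArg (adjointCLM I) hx.symm
  intro g
  have htranslate : ContMDiffAt I 𝓘(ℝ, E →L[ℝ] E) ∞ (fun x : G => adjointCLM I (g⁻¹ * x)) g :=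
    ContMDiffAt.comp g (g := fun x : G => adjointCLM I x) (by simpa using hone)
      (contMDiffAt_const.mul contMDiffAt_id)
  refine ((contMDiffAt_const (c := adjointCLM I g)).clm_comp htranslate).congr_of_eventuallyEq
    (Eventually.of_forall fun x => ?_)
  simp [← adjointCLM_mul]

end Adjoint

/-! ### Logarithmic derivatives of curves -/

section LeftLogDeriv

variable {E : Type*} [NormedAddCommGroup E] [NormedSpace ℝ E]
  {H : Type*} [TopologicalSpace H] (I : ModelWithCorners ℝ E H)
  {G : Type*} [TopologicalSpace G] [ChartedSpace H G] [Group G]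

/-- `ξ` is the left logarithmic derivative `γ⁻¹ dγ/dτ` of the curve `γ` at the time `θ`: the
velocity at `θ` of the curve `τ ↦ γ(θ)⁻¹ γ(τ)` through the identity, read in the unit chart. -/
def HasLeftLogDerivAt (γ : ℝ → G) (ξ : E) (θ : ℝ) : Prop :=
  ContinuousAt γ θ ∧ HasDerivAt (fun τ => unitChart I G ((γ θ)⁻¹ * γ τ)) ξ θ

/-- The derivative at `1` of the left translation by `x`, read in the unit chart at both ends. -/
def leftTransDeriv (x : G) : E →L[ℝ] E :=
  fderiv ℝ (fun z => unitChart I G (x * (unitChart I G).symm z)) (unitCoord I G)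

variable (G) in
/-- The left Maurer–Cartan form in the unit chart; `maurerCartanChart I G y` inverts the derivative
`leftTransDeriv` of the left translation by the point with coordinates `y`. -/
def maurerCartanChart (y : E) : E →L[ℝ] E :=
  fderiv ℝ (fun z => unitChart I G (((unitChart I G).symm y)⁻¹ * (unitChart I G).symm z)) y

variable {I}

theorem hasLeftLogDerivAt_const (x : G) (θ : ℝ) : HasLeftLogDerivAt I (fun _ => x) 0 θ :=
  ⟨continuousAt_const, by simpa using hasDerivAt_const θ _⟩

section LieGroup

variable [LieGroup I ∞ G]

theorem contDiffAt_maurerCartanChart [I.Boundaryless] {y : E}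
    (hy : y ∈ (unitChart I G).target) : ContDiffAt ℝ ∞ (maurerCartanChart I G) y :=
  ContDiffAt.fderiv (m := ∞) (x₀ := y) (g := fun y => y)
    (f := fun y z => unitChart I G (((unitChart I G).symm y)⁻¹ * (unitChart I G).symm z))
    (contDiffAt_chartLeftDiv hy hy (by simp)) contDiffAt_id (by simp)

theorem contDiffAt_leftTransDeriv_unitChart_symm [I.Boundaryless] {y : E}
    (hy : y ∈ (unitChart I G).target) :
    ContDiffAt ℝ ∞ (fun y => leftTransDeriv I ((unitChart I G).symm y)) y :=
  ContDiffAt.fderiv (m := ∞) (x₀ := y) (g := fun _ => unitCoord I G)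
    (f := fun y z => unitChart I G ((unitChart I G).symm y * (unitChart I G).symm z))
    (contDiffAt_chartMul hy (unitCoord_mem_target I G)
      (by simpa using (unitChart I G).map_target hy)) contDiffAt_const (by simp)

theorem hasFDerivAt_leftTransDeriv [I.Boundaryless] {x : G} (hx : x ∈ (unitChart I G).source) :
    HasFDerivAt (fun z => unitChart I G (x * (unitChart I G).symm z)) (leftTransDeriv I x)
      (unitCoord I G) :=
  ((contDiffAt_unitChart_comp (contMDiffAt_const.mul
    (contMDiffAt_unitChart_symm (unitCoord_mem_target I G))) (by simpa using hx)).differentiableAt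
      (by simp)).hasFDerivAt

theorem hasFDerivAt_maurerCartanChart [I.Boundaryless] {y : E}
    (hy : y ∈ (unitChart I G).target) :
    HasFDerivAt (fun z => unitChart I G (((unitChart I G).symm y)⁻¹ * (unitChart I G).symm z))
      (maurerCartanChart I G y) y :=
  ((contDiffAt_unitChart_comp (contMDiffAt_const.mul
    (contMDiffAt_unitChart_symm hy)) (by simp)).differentiableAt (by simp)).hasFDerivAt

theorem maurerCartanChart_leftTransDeriv [I.Boundaryless] {y : E}
    (hy : y ∈ (unitChart I G).target) (ξ : E) :
    maurerCartanChart I G y (leftTransDeriv I ((unitChart I G).symm y) ξ) = ξ := by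
  have hcomp := HasFDerivAt.comp (unitCoord I G)
    (by simpa [(unitChart I G).right_inv hy] using hasFDerivAt_maurerCartanChart (I := I) hy)
    (hasFDerivAt_leftTransDeriv ((unitChart I G).map_target hy))
  have hmem : ∀ᶠ z in 𝓝 (unitCoord I G),
      (unitChart I G).symm y * (unitChart I G).symm z ∈ (unitChart I G).source :=
    (contMDiffAt_const.mul
      (contMDiffAt_unitChart_symm (unitCoord_mem_target I G))).continuousAt.eventually_mem
      ((isOpen_unitChart_source I G).mem_nhds (by simpa using (unitChart I G).map_target hy))
  refine DFunLike.congr_fun (hcomp.unique ((hasFDerivAt_id _).congr_of_eventuallyEq ?_)) ξ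
  filter_upwards [hmem, eventually_unitChart_apply_symm I G] with z hz hz'
  simp [(unitChart I G).left_inv hz, hz']

theorem hasLeftLogDerivAt_unitChart_symm_comp [I.Boundaryless] {y : ℝ → E} {η : E} {θ : ℝ}
    (h : HasDerivAt y η θ) (hθ : y θ ∈ (unitChart I G).target) :
    HasLeftLogDerivAt I (fun τ => (unitChart I G).symm (y τ)) (maurerCartanChart I G (y θ) η) θ :=
  ⟨(contMDiffAt_unitChart_symm hθ).continuousAt.comp_of_eq h.continuousAt rfl,
    HasFDerivAt.comp_hasDerivAt θ (hasFDerivAt_maurerCartanChart hθ) h⟩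

theorem hasLeftLogDerivAt_mfderiv {γ : ℝ → G} {θ : ℝ} (h : MDifferentiableAt 𝓘(ℝ, ℝ) I γ θ) :
    HasLeftLogDerivAt I γ
      (mfderiv 𝓘(ℝ, ℝ) I (fun τ : ℝ => (γ θ)⁻¹ * γ τ) θ (1 : ℝ) : E) θ := by
  have hleft : MDifferentiableAt I I (fun x => (γ θ)⁻¹ * x) (γ θ) :=
    (contMDiff_const.mul contMDiff_id : ContMDiff I I ∞ fun x => (γ θ)⁻¹ * x).mdifferentiableAt
      (by simp)
  have hderiv := (hleft.comp θ h).hasMFDerivAt.2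
  simp only [writtenInExtChartAt, Function.comp_def, inv_mul_cancel, modelWithCornersSelf_coe,
    range_id] at hderiv
  exact ⟨h.continuousAt, HasFDerivAt.hasDerivAt (hasFDerivWithinAt_univ.1 hderiv)⟩

end LieGroup

namespace HasLeftLogDerivAt

variable {γ δ : ℝ → G} {ξ η : E} {θ : ℝ}

theorem unique (h : HasLeftLogDerivAt I γ ξ θ) (h' : HasLeftLogDerivAt I γ η θ) : ξ = η :=
  h.2.unique h'.2

theorem congr_of_eventuallyEq (h : HasLeftLogDerivAt I γ ξ θ) (e : δ =ᶠ[𝓝 θ] γ) :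
    HasLeftLogDerivAt I δ ξ θ :=
  ⟨h.1.congr_of_eventuallyEq e, h.2.congr_of_eventuallyEq <| by
    filter_upwards [e] with τ hτ
    rw [hτ, e.eq_of_nhds]⟩

theorem comp_hasDerivAt {f : ℝ → ℝ} {f' : ℝ} (h : HasLeftLogDerivAt I γ ξ (f θ))
    (hf : HasDerivAt f f' θ) : HasLeftLogDerivAt I (fun τ => γ (f τ)) (f' • ξ) θ :=
  ⟨h.1.comp_of_eq hf.continuousAt rfl, HasDerivAt.scomp θ h.2 hf⟩

variable [LieGroup I ∞ G]

theorem const_mul (h : HasLeftLogDerivAt I γ ξ θ) (x : G) :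
    HasLeftLogDerivAt I (fun τ => x * γ τ) ξ θ := by
  have := topologicalGroup_of_lieGroup I ∞ (G := G)
  exact ⟨continuousAt_const.mul h.1, by simpa [mul_assoc] using h.2⟩

theorem continuousAt_leftDiv (h : HasLeftLogDerivAt I γ ξ θ) :
    ContinuousAt (fun τ => (γ θ)⁻¹ * γ τ) θ :=
  (h.const_mul _).1

theorem hasDerivAt_comp {V : Type*} [NormedAddCommGroup V] [NormedSpace ℝ V]
    (h : HasLeftLogDerivAt I γ ξ θ) {f : G → V} {D : E →L[ℝ] V}
    (hf : HasFDerivAt (fun y => f ((unitChart I G).symm y)) D (unitCoord I G)) :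
    HasDerivAt (fun τ => f ((γ θ)⁻¹ * γ τ)) (D ξ) θ :=
  hasDerivAt_comp_of_unitChart (by simp) hf h.continuousAt_leftDiv h.2

variable [I.Boundaryless]

theorem hasDerivAt_unitChart (h : HasLeftLogDerivAt I γ ξ θ)
    (hθ : γ θ ∈ (unitChart I G).source) :
    HasDerivAt (fun τ => unitChart I G (γ τ)) (leftTransDeriv I (γ θ) ξ) θ := by
  simpa using h.hasDerivAt_comp (f := fun x => unitChart I G (γ θ * x))
    (hasFDerivAt_leftTransDeriv hθ)

theorem mul (hγ : HasLeftLogDerivAt I γ ξ θ) (hδ : HasLeftLogDerivAt I δ η θ) :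
    HasLeftLogDerivAt I (fun τ => γ τ * δ τ) (adjointCLM I (δ θ)⁻¹ ξ + η) θ := by
  have := topologicalGroup_of_lieGroup I ∞ (G := G)
  -- `(γ(θ) δ(θ))⁻¹ γ δ` is the product of the `δ(θ)⁻¹`-conjugate of `γ(θ)⁻¹ γ` and of `δ(θ)⁻¹ δ`.
  have hconj := hγ.hasDerivAt_comp (f := fun x => unitChart I G ((δ θ)⁻¹ * x * ((δ θ)⁻¹)⁻¹))
    (hasFDerivAt_chartConj (I := I) (δ θ)⁻¹)
  have hmul := HasFDerivAt.comp_hasDerivAt θ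
    (by simpa using hasFDerivAt_chartMul (I := I) (G := G)) (hconj.prodMk hδ.2)
  have hcont : ContinuousAt (fun τ => (δ θ)⁻¹ * ((γ θ)⁻¹ * γ τ) * ((δ θ)⁻¹)⁻¹) θ :=
    (continuousAt_const.mul hγ.continuousAt_leftDiv).mul continuousAt_const
  refine ⟨hγ.1.mul hδ.1, hmul.congr_of_eventuallyEq ?_⟩
  filter_upwards [eventually_unitChart_symm_apply I hcont (by simp),
    eventually_unitChart_symm_apply I hδ.continuousAt_leftDiv (by simp)] with τ hγτ hδτ
  simp only [Function.comp_apply, hγτ, hδτ]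
  congr 1
  group

theorem mul_const (h : HasLeftLogDerivAt I γ ξ θ) (x : G) :
    HasLeftLogDerivAt I (fun τ => γ τ * x) (adjointCLM I x⁻¹ ξ) θ := by
  simpa using h.mul (hasLeftLogDerivAt_const x θ)

theorem inv (h : HasLeftLogDerivAt I γ ξ θ) :
    HasLeftLogDerivAt I (fun τ => (γ τ)⁻¹) (-adjointCLM I (γ θ) ξ) θ := by
  have := topologicalGroup_of_lieGroup I ∞ (G := G)
  have hconj := h.hasDerivAt_comp (f := fun x => unitChart I G (γ θ * x * (γ θ)⁻¹))
    (hasFDerivAt_chartConj (I := I) (γ θ))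
  have hinv := HasFDerivAt.comp_hasDerivAt θ
    (by simpa using hasFDerivAt_chartInv (I := I) (G := G)) hconj
  have hcont : ContinuousAt (fun τ => γ θ * ((γ θ)⁻¹ * γ τ) * (γ θ)⁻¹) θ :=
    (continuousAt_const.mul h.continuousAt_leftDiv).mul continuousAt_const
  refine ⟨h.1.inv, hinv.congr_of_eventuallyEq ?_⟩
  filter_upwards [eventually_unitChart_symm_apply I hcont (by simp)] with τ hτ
  simp only [Function.comp_apply, hτ]
  congr 1
  group

theorem hasDerivAt_adjointCLM (h : HasLeftLogDerivAt I γ ξ θ) :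
    HasDerivAt (fun τ => adjointCLM I (γ τ))
      ((adjointCLM I (γ θ)).comp (adjointDeriv I G ξ)) θ := by
  simpa [← adjointCLM_mul] using (hasDerivAt_const θ (adjointCLM I (γ θ))).clm_comp
    (h.hasDerivAt_comp (hasFDerivAt_adjointCLM_unitChart_symm (I := I) (G := G)))

end HasLeftLogDerivAt

end LeftLogDeriv

/-- A time-dependent equation `α' = f(t, α)` is the autonomous equation of `(1, f)` on `ℝ × E`. -/
theorem exists_eventually_hasDerivAt_of_contDiffAt {E : Type*} [NormedAddCommGroup E]
    [NormedSpace ℝ E] [CompleteSpace E] {f : ℝ → E → E} {t₀ : ℝ} {x₀ : E}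
    (hf : ContDiffAt ℝ 1 (fun p : ℝ × E => f p.1 p.2) (t₀, x₀)) :
    ∃ α : ℝ → E, α t₀ = x₀ ∧ ∀ᶠ t in 𝓝 t₀, HasDerivAt α (f t (α t)) t := by
  have hF : ContDiffAt ℝ 1 (fun p : ℝ × E => ((1 : ℝ), f p.1 p.2)) (t₀, x₀) :=
    contDiffAt_const.prodMk hf
  obtain ⟨r, hr, ε, hε, hβ⟩ :=
    hF.exists_forall_mem_closedBall_exists_eq_forall_mem_Ioo_hasDerivAt t₀
  obtain ⟨β, hβ₀, hβ⟩ := hβ _ (Metric.mem_closedBall_self hr.le)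
  have ht₀ : t₀ ∈ Ioo (t₀ - ε) (t₀ + ε) := ⟨by linarith, by linarith⟩
  have hfst : ∀ s ∈ Ioo (t₀ - ε) (t₀ + ε), HasDerivAt (fun s => (β s).1) 1 s := fun s hs =>
    (hasFDerivAt_fst (𝕜 := ℝ) (p := β s)).comp_hasDerivAt s (hβ s hs)
  have hsnd : ∀ s ∈ Ioo (t₀ - ε) (t₀ + ε),
      HasDerivAt (fun s => (β s).2) (f (β s).1 (β s).2) s := fun s hs =>
    (hasFDerivAt_snd (𝕜 := ℝ) (p := β s)).comp_hasDerivAt s (hβ s hs)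
  have hclock : EqOn (fun s => (β s).1) id (Ioo (t₀ - ε) (t₀ + ε)) :=
    isOpen_Ioo.eqOn_of_deriv_eq isPreconnected_Ioo
      (fun s hs => (hfst s hs).differentiableAt.differentiableWithinAt) differentiableOn_id
      (fun s hs => by rw [(hfst s hs).deriv, deriv_id]) ht₀ (by simp [hβ₀])
  refine ⟨fun t => (β t).2, by simp [hβ₀], ?_⟩
  filter_upwards [isOpen_Ioo.mem_nhds ht₀] with t ht
  have hβt : (β t).1 = t := hclock ht
  simpa only [hβt] using hsnd t ht

theorem exists_eqOn_Ioo_of_forall_eqOn_Ioo {α : Type*} {γ : ℕ → ℝ → α}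
    (h : ∀ m n, m ≤ n → EqOn (γ n) (γ m) (Ioo (-(m : ℝ)) m)) :
    ∃ η : ℝ → α, ∀ n : ℕ, EqOn η (γ n) (Ioo (-(n : ℝ)) n) := by
  refine ⟨fun τ => γ (⌊|τ|⌋₊ + 1) τ, fun n τ hτ => ?_⟩
  have hτn : |τ| < n := abs_lt.2 hτ
  have hle : ⌊|τ|⌋₊ + 1 ≤ n := (Nat.floor_lt (abs_nonneg τ)).2 hτn
  refine (h _ n hle ?_).symm
  push_cast
  exact abs_lt.1 (Nat.lt_floor_add_one |τ|)

section Existence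

variable {E : Type*} [NormedAddCommGroup E] [NormedSpace ℝ E]
  {H : Type*} [TopologicalSpace H] {I : ModelWithCorners ℝ E H}
  {G : Type*} [TopologicalSpace G] [ChartedSpace H G] [Group G]

namespace HasLeftLogDerivAt

theorem ite_le {γ δ : ℝ → G} {ξ : E} {b : ℝ} (hγ : HasLeftLogDerivAt I γ ξ b)
    (hδ : HasLeftLogDerivAt I δ ξ b) (hb : γ b = δ b) :
    HasLeftLogDerivAt I (fun τ => if τ ≤ b then γ τ else δ τ) ξ b := by
  have hleft : EqOn (fun τ => if τ ≤ b then γ τ else δ τ) γ (Iic b) := fun τ hτ => if_pos hτ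
  have hright : EqOn (fun τ => if τ ≤ b then γ τ else δ τ) δ (Ici b) := fun τ hτ => by
    rcases (mem_Ici.1 hτ).eq_or_lt with rfl | h
    · exact (if_pos le_rfl).trans hb
    · exact if_neg h.not_ge
  refine ⟨?_, ?_⟩
  · rw [← continuousWithinAt_univ, ← Iic_union_Ici (a := b)]
    exact (hγ.1.continuousWithinAt.congr hleft (hleft self_mem_Iic)).union
      (hδ.1.continuousWithinAt.congr hright (hright self_mem_Ici))
  · rw [← hasDerivWithinAt_univ, ← Iic_union_Ici (a := b)]
    refine (hγ.2.hasDerivWithinAt.congr (fun τ hτ => ?_) ?_).union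
      (hδ.2.hasDerivWithinAt.congr (fun τ hτ => ?_) ?_)
    · simp only [hleft hτ, hleft self_mem_Iic]
    · simp only [hleft self_mem_Iic]
    · simp only [hright hτ, hright self_mem_Ici]
    · simp only [hright self_mem_Ici]

end HasLeftLogDerivAt

variable [LieGroup I ∞ G]

theorem exists_hasLeftLogDerivAt_Icc_trans {γ δ : ℝ → G} {c : ℝ → E} {a b d : ℝ}
    (hγ : ∀ θ ∈ Icc a b, HasLeftLogDerivAt I γ (c θ) θ)
    (hδ : ∀ θ ∈ Icc b d, HasLeftLogDerivAt I δ (c θ) θ) :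
    ∃ η : ℝ → G, ∀ θ ∈ Icc a d, HasLeftLogDerivAt I η (c θ) θ := by
  have := topologicalGroup_of_lieGroup I ∞ (G := G)
  have hδ' : ∀ θ ∈ Icc b d, HasLeftLogDerivAt I (fun τ => γ b * (δ b)⁻¹ * δ τ) (c θ) θ :=
    fun θ hθ => (hδ θ hθ).const_mul _
  refine ⟨fun τ => if τ ≤ b then γ τ else γ b * (δ b)⁻¹ * δ τ, fun θ hθ => ?_⟩
  rcases lt_trichotomy θ b with h | rfl | h
  · refine (hγ θ ⟨hθ.1, h.le⟩).congr_of_eventuallyEq ?_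
    filter_upwards [Iio_mem_nhds h] with τ hτ
    exact if_pos (le_of_lt hτ)
  · exact (hγ θ ⟨hθ.1, le_rfl⟩).ite_le (hδ' θ ⟨le_rfl, hθ.2⟩) (by simp)
  · refine (hδ' θ ⟨h.le, hθ.2⟩).congr_of_eventuallyEq ?_
    filter_upwards [Ioi_mem_nhds h] with τ hτ
    exact if_neg (not_le.2 hτ)

variable [I.Boundaryless]

theorem eventually_eq_of_hasLeftLogDerivAt_zero {γ : ℝ → G} {θ₀ : ℝ}
    (h : ∀ᶠ θ in 𝓝 θ₀, HasLeftLogDerivAt I γ 0 θ) : ∀ᶠ θ in 𝓝 θ₀, γ θ = γ θ₀ := by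
  have hsource : ∀ᶠ θ in 𝓝 θ₀, (γ θ₀)⁻¹ * γ θ ∈ (unitChart I G).source :=
    eventually_mem_unitChart_source I h.self_of_nhds.continuousAt_leftDiv (by simp)
  obtain ⟨ε, hε, hball⟩ := Metric.eventually_nhds_iff_ball.1 (h.and hsource)
  have hderiv : ∀ τ ∈ Metric.ball θ₀ ε,
      HasDerivAt (fun τ => unitChart I G ((γ θ₀)⁻¹ * γ τ)) 0 τ := fun τ hτ => by
    simpa using ((hball τ hτ).1.const_mul _).hasDerivAt_unitChart (hball τ hτ).2
  filter_upwards [Metric.ball_mem_nhds θ₀ hε] with θ hθ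
  have hchart := Metric.isOpen_ball.is_const_of_deriv_eq_zero (convex_ball θ₀ ε).isPreconnected
    (fun τ hτ => (hderiv τ hτ).differentiableAt.differentiableWithinAt)
    (fun τ hτ => (hderiv τ hτ).deriv) hθ (Metric.mem_ball_self hε)
  exact mul_left_cancel ((unitChart I G).injOn (hball θ hθ).2
    (hball θ₀ (Metric.mem_ball_self hε)).2 hchart)

theorem eq_of_hasLeftLogDerivAt_zero {γ : ℝ → G} {S : Set ℝ} (hS : IsOpen S)
    (hp : IsPreconnected S) (h : ∀ θ ∈ S, HasLeftLogDerivAt I γ 0 θ) {a b : ℝ} (ha : a ∈ S)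
    (hb : b ∈ S) : γ a = γ b := by
  have : PreconnectedSpace S := Subtype.preconnectedSpace hp
  have hconst : IsLocallyConstant (fun x : S => γ x) :=
    (IsLocallyConstant.iff_eventually_eq _).2 fun x =>
      continuous_subtype_val.continuousAt.eventually
        (eventually_eq_of_hasLeftLogDerivAt_zero (I := I) <|
          (hS.eventually_mem x.2).mono h)
  exact hconst.apply_eq_of_preconnectedSpace ⟨a, ha⟩ ⟨b, hb⟩

theorem eqOn_of_hasLeftLogDerivAt {γ δ : ℝ → G} {c : ℝ → E} {S : Set ℝ} (hS : IsOpen S)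
    (hp : IsPreconnected S) (hγ : ∀ θ ∈ S, HasLeftLogDerivAt I γ (c θ) θ)
    (hδ : ∀ θ ∈ S, HasLeftLogDerivAt I δ (c θ) θ) {a : ℝ} (ha : a ∈ S) (e : γ a = δ a) :
    EqOn γ δ S := by
  intro b hb
  have hdiv : ∀ θ ∈ S, HasLeftLogDerivAt I (fun τ => γ τ * (δ τ)⁻¹) 0 θ := fun θ hθ => by
    simpa using (hγ θ hθ).mul (hδ θ hθ).inv
  have hconst := eq_of_hasLeftLogDerivAt_zero hS hp hdiv ha hb
  rw [e, mul_inv_cancel] at hconst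
  exact mul_inv_eq_one.1 hconst.symm

theorem eq_of_hasLeftLogDerivAt {γ δ : ℝ → G} {c : ℝ → E}
    (hγ : ∀ θ, HasLeftLogDerivAt I γ (c θ) θ) (hδ : ∀ θ, HasLeftLogDerivAt I δ (c θ) θ) {a : ℝ}
    (e : γ a = δ a) : γ = δ :=
  funext fun b => eqOn_of_hasLeftLogDerivAt isOpen_univ isPreconnected_univ (fun θ _ => hγ θ)
    (fun θ _ => hδ θ) (mem_univ a) e (mem_univ b)

theorem exists_eventually_hasLeftLogDerivAt [CompleteSpace E] {c : ℝ → E} {θ₀ : ℝ}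
    (hc : ContDiffAt ℝ 1 c θ₀) :
    ∃ γ : ℝ → G, ∀ᶠ θ in 𝓝 θ₀, HasLeftLogDerivAt I γ (c θ) θ := by
  have hf : ContDiffAt ℝ 1
      (fun p : ℝ × E => leftTransDeriv I ((unitChart I G).symm p.2) (c p.1))
      (θ₀, unitCoord I G) := by
    have hL := (contDiffAt_leftTransDeriv_unitChart_symm (unitCoord_mem_target I G)).comp
      (θ₀, unitCoord I G) contDiffAt_snd
    exact (hL.of_le (mod_cast le_top)).clm_apply (hc.comp (θ₀, unitCoord I G) contDiffAt_fst)
  obtain ⟨α, hα₀, hα⟩ := exists_eventually_hasDerivAt_of_contDiffAt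
    (f := fun t x => leftTransDeriv I ((unitChart I G).symm x) (c t)) hf
  have htarget : ∀ᶠ t in 𝓝 θ₀, α t ∈ (unitChart I G).target :=
    hα.self_of_nhds.continuousAt.eventually_mem (by rw [hα₀]; exact unitChart_target_mem_nhds I G)
  refine ⟨fun t => (unitChart I G).symm (α t), ?_⟩
  filter_upwards [hα, htarget] with t ht hmem
  have hlog := hasLeftLogDerivAt_unitChart_symm_comp ht hmem
  rwa [maurerCartanChart_leftTransDeriv hmem] at hlog

theorem exists_hasLeftLogDerivAt_Icc [CompleteSpace E] {c : ℝ → E} (hc : ContDiff ℝ 1 c)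
    (a b : ℝ) : ∃ γ : ℝ → G, ∀ θ ∈ Icc a b, HasLeftLogDerivAt I γ (c θ) θ := by
  rcases lt_or_ge b a with hab | hab
  · exact ⟨1, by simp [Icc_eq_empty hab.not_ge]⟩
  choose γ hγ using fun θ₀ : Icc a b =>
    exists_eventually_hasLeftLogDerivAt (I := I) (G := G) (hc.contDiffAt (x := (θ₀ : ℝ)))
  choose U hU hUo hUm using fun θ₀ : Icc a b => eventually_nhds_iff.1 (hγ θ₀)
  obtain ⟨t, ht₀, -, ⟨m, hm⟩, ht⟩ := exists_monotone_Icc_subset_open_cover_Icc hab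
    (c := fun θ₀ : Icc a b => Subtype.val ⁻¹' (U θ₀))
    (fun θ₀ => (hUo θ₀).preimage continuous_subtype_val)
    (fun θ _ => mem_iUnion.2 ⟨θ, hUm θ⟩)
  have hstep : ∀ n, ∃ η : ℝ → G, ∀ θ ∈ Icc a (t n), HasLeftLogDerivAt I η (c θ) θ := by
    intro n
    induction n with
    | zero =>
      refine ⟨γ ⟨a, le_rfl, hab⟩, fun θ hθ => ?_⟩
      obtain rfl : θ = a := by rwa [ht₀, Icc_self, mem_singleton_iff] at hθ
      exact (hγ ⟨θ, le_rfl, hab⟩).self_of_nhds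
    | succ n ih =>
      obtain ⟨η, hη⟩ := ih
      obtain ⟨i, hi⟩ := ht n
      refine exists_hasLeftLogDerivAt_Icc_trans hη (δ := γ i) fun θ hθ => hU i θ ?_
      have hmem : θ ∈ Icc a b := ⟨(t n).2.1.trans hθ.1, hθ.2.trans (t (n + 1)).2.2⟩
      exact hi (show (⟨θ, hmem⟩ : Icc a b) ∈ Icc (t n) (t (n + 1)) from hθ)
  obtain ⟨η, hη⟩ := hstep m
  exact ⟨η, by rwa [hm m le_rfl] at hη⟩

theorem exists_hasLeftLogDerivAt [CompleteSpace E] {c : ℝ → E} (hc : ContDiff ℝ 1 c) :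
    ∃ γ : ℝ → G, γ 0 = 1 ∧ ∀ θ, HasLeftLogDerivAt I γ (c θ) θ := by
  choose γ hγ using fun n : ℕ => exists_hasLeftLogDerivAt_Icc (I := I) (G := G) hc (-n) n
  have hcurve : ∀ n : ℕ, ∀ θ ∈ Ioo (-(n : ℝ)) n,
      HasLeftLogDerivAt I (fun τ => (γ n 0)⁻¹ * γ n τ) (c θ) θ :=
    fun n θ hθ => (hγ n θ (Ioo_subset_Icc_self hθ)).const_mul _
  have hcompat : ∀ m n : ℕ, m ≤ n → EqOn (fun τ => (γ n 0)⁻¹ * γ n τ)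
      (fun τ => (γ m 0)⁻¹ * γ m τ) (Ioo (-(m : ℝ)) m) := fun m n hmn τ hτ => by
    have hmn' : (m : ℝ) ≤ n := mod_cast hmn
    exact eqOn_of_hasLeftLogDerivAt isOpen_Ioo isPreconnected_Ioo
      (fun θ hθ => hcurve n θ (Ioo_subset_Ioo (neg_le_neg hmn') hmn' hθ)) (hcurve m) (a := 0)
      ⟨by linarith [hτ.1, hτ.2], by linarith [hτ.1, hτ.2]⟩ (by simp) hτ
  obtain ⟨η, hη⟩ := exists_eqOn_Ioo_of_forall_eqOn_Ioo hcompat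
  refine ⟨η, (hη 1 (by simp)).trans (by simp), fun θ => ?_⟩
  obtain ⟨n, hn⟩ := exists_nat_gt |θ|
  exact (hcurve n θ (abs_lt.1 hn)).congr_of_eventuallyEq
    ((hη n).eventuallyEq_of_mem (isOpen_Ioo.mem_nhds (abs_lt.1 hn)))

theorem contMDiff_of_hasLeftLogDerivAt [CompleteSpace E] {γ : ℝ → G} {c : ℝ → E}
    (hc : ContDiff ℝ ∞ c) (h : ∀ θ, HasLeftLogDerivAt I γ (c θ) θ) :
    ContMDiff 𝓘(ℝ, ℝ) I ∞ γ := by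
  intro θ₀
  have hsource : ∀ᶠ θ in 𝓝 θ₀, (γ θ₀)⁻¹ * γ θ ∈ (unitChart I G).source :=
    eventually_mem_unitChart_source I (h θ₀).continuousAt_leftDiv (by simp)
  obtain ⟨ε, hε, hball⟩ := Metric.nhds_basis_closedBall.eventually_iff.1 hsource
  rw [Real.closedBall_eq_Icc] at hball
  have hnhds : Icc (θ₀ - ε) (θ₀ + ε) ∈ 𝓝 θ₀ := Icc_mem_nhds (by linarith) (by linarith)
  have hchart : ContDiffOn ℝ ∞ (fun τ => unitChart I G ((γ θ₀)⁻¹ * γ τ))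
      (Icc (θ₀ - ε) (θ₀ + ε)) := by
    refine ODE.contDiffOn_enat_Icc_of_hasDerivWithinAt (n := ⊤) (u := (unitChart I G).target)
      (f := fun τ z => leftTransDeriv I ((unitChart I G).symm z) (c τ)) ?_ (fun τ hτ => ?_)
      fun τ hτ => (unitChart I G).map_source (hball hτ)
    · rintro ⟨τ, z⟩ ⟨-, hz⟩
      exact (((contDiffAt_leftTransDeriv_unitChart_symm hz).comp (τ, z) contDiffAt_snd).clm_apply
        (hc.contDiffAt.comp (τ, z) contDiffAt_fst)).contDiffWithinAt
    · rw [(unitChart I G).left_inv (hball hτ)]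
      exact (((h τ).const_mul _).hasDerivAt_unitChart (hball hτ)).hasDerivWithinAt
  have hlift : ContMDiffAt 𝓘(ℝ, ℝ) I ∞
      (fun τ => γ θ₀ * (unitChart I G).symm (unitChart I G ((γ θ₀)⁻¹ * γ τ))) θ₀ :=
    contMDiffAt_const.mul (ContMDiffAt.comp θ₀
      (contMDiffAt_unitChart_symm ((unitChart I G).map_source hsource.self_of_nhds))
      (hchart.contDiffAt hnhds).contMDiffAt)
  refine hlift.congr_of_eventuallyEq ?_
  filter_upwards [hsource] with τ hτ
  rw [(unitChart I G).left_inv hτ, mul_inv_cancel_left]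

theorem contDiff_of_hasLeftLogDerivAt {γ : ℝ → G} {c : ℝ → E}
    (hγ : ContMDiff 𝓘(ℝ, ℝ) I ∞ γ) (h : ∀ θ, HasLeftLogDerivAt I γ (c θ) θ) :
    ContDiff ℝ ∞ c := by
  refine contDiff_iff_contDiffAt.2 fun θ₀ => ?_
  have hsource : ∀ᶠ θ in 𝓝 θ₀, (γ θ₀)⁻¹ * γ θ ∈ (unitChart I G).source :=
    eventually_mem_unitChart_source I (h θ₀).continuousAt_leftDiv (by simp)
  have hchart : ContDiffAt ℝ ∞ (fun τ => unitChart I G ((γ θ₀)⁻¹ * γ τ)) θ₀ :=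
    contDiffAt_unitChart_comp (contMDiffAt_const.mul hγ.contMDiffAt) hsource.self_of_nhds
  have hMC : ContDiffAt ℝ ∞ (fun τ => maurerCartanChart I G (unitChart I G ((γ θ₀)⁻¹ * γ τ))
      (deriv (fun τ => unitChart I G ((γ θ₀)⁻¹ * γ τ)) τ)) θ₀ :=
    ((contDiffAt_maurerCartanChart ((unitChart I G).map_source hsource.self_of_nhds)).comp θ₀
      hchart).clm_apply ((hchart.fderiv_right (m := ∞) (by simp)).clm_apply contDiffAt_const)
  refine hMC.congr_of_eventuallyEq ?_
  filter_upwards [hsource] with θ hθ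
  have hcoeff := maurerCartanChart_leftTransDeriv ((unitChart I G).map_source hθ) (c θ)
  rw [(unitChart I G).left_inv hθ] at hcoeff
  rw [(((h θ).const_mul _).hasDerivAt_unitChart hθ).deriv, hcoeff]

end Existence

theorem Icc_subset_of_norm_deriv_le {E : Type*} [NormedAddCommGroup E] [NormedSpace ℝ E]
    {y y' : ℝ → E} {S : Set ℝ} {T r C : ℝ} (hS : IsClosed (Icc 0 T ∩ S)) (h0 : 0 ∈ S)
    (hy : ∀ θ ∈ Icc 0 T ∩ S, HasDerivAt y (y' θ) θ) (hbound : ∀ θ ∈ Icc 0 T ∩ S, ‖y' θ‖ ≤ C)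
    (hopen : ∀ θ ∈ Icc 0 T ∩ S, ‖y θ - y 0‖ < r → S ∈ 𝓝 θ) (hr : 0 < r) (hCT : C * T < r) :
    Icc 0 T ⊆ S := by
  suffices h : Icc 0 T ⊆ {θ | Icc 0 θ ⊆ S} from fun θ hθ => h hθ (right_mem_Icc.2 hθ.1)
  refine IsClosed.Icc_subset_of_forall_mem_nhdsWithin ?_ (by simpa using h0) ?_
  · refine isClosed_of_closure_subset fun θ hθ => ⟨fun x hx => ?_, ?_⟩
    · rcases hx.2.lt_or_eq with hlt | rfl
      · obtain ⟨θ', hθ', hsub, -⟩ := mem_closure_iff_nhds.1 hθ _ (Ioi_mem_nhds hlt)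
        exact hsub ⟨hx.1, le_of_lt hθ'⟩
      · refine (hS.closure_subset (closure_mono ?_ hθ)).2
        exact fun τ hτ => ⟨hτ.2, hτ.1 (right_mem_Icc.2 hτ.2.1)⟩
    · exact isClosed_Icc.closure_subset (closure_mono inter_subset_right hθ)
  · rintro θ ⟨hsub, hθ0, hθT⟩
    have hmem : ∀ τ ∈ Icc 0 θ, τ ∈ Icc 0 T ∩ S := fun τ hτ =>
      ⟨⟨hτ.1, hτ.2.trans hθT.le⟩, hsub hτ⟩
    have hdist : ‖y θ - y 0‖ < r := by
      have hle := norm_image_sub_le_of_norm_deriv_le_segment'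
        (fun τ hτ => (hy τ (hmem τ hτ)).hasDerivWithinAt)
        (fun τ hτ => hbound τ (hmem τ (Ico_subset_Icc_self hτ))) θ (right_mem_Icc.2 hθ0)
      rcases le_or_gt 0 C with hC | hC
      · nlinarith
      · nlinarith
    obtain ⟨ε, hε, hball⟩ := Metric.mem_nhds_iff.1
      (hopen θ (hmem θ (right_mem_Icc.2 hθ0)) hdist)
    filter_upwards [Ioo_mem_nhdsGT (lt_add_of_pos_right θ hε)] with τ hτ x hx
    rcases le_total x θ with hxθ | hxθ
    · exact hsub ⟨hx.1, hxθ⟩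
    · refine hball ?_
      rw [Metric.mem_ball, Real.dist_eq, abs_lt]
      constructor <;> linarith [hx.2, hτ.2]

section ContinuousDependence

variable {E : Type*} [NormedAddCommGroup E] [NormedSpace ℝ E]
  {H : Type*} [TopologicalSpace H] {I : ModelWithCorners ℝ E H}
  {G : Type*} [TopologicalSpace G] [ChartedSpace H G] [Group G]
  [LieGroup I ∞ G] [I.Boundaryless]

theorem exists_isClosed_unitChart_symm_image_closedBall {s : Set E}
    (hs : s ∈ 𝓝 (unitCoord I G)) :
    ∃ r > 0, Metric.closedBall (unitCoord I G) r ⊆ s ∩ (unitChart I G).target ∧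
      IsClosed ((unitChart I G).symm '' Metric.closedBall (unitCoord I G) r) := by
  have := topologicalGroup_of_lieGroup I ∞ (G := G)
  obtain ⟨N, hN, hNclosed, hNsource⟩ := exists_mem_nhds_isClosed_subset
    ((isOpen_unitChart_source I G).mem_nhds (one_mem_unitChart_source I G))
  have hsymm : ∀ᶠ y in 𝓝 (unitCoord I G), (unitChart I G).symm y ∈ N :=
    (contMDiffAt_unitChart_symm (unitCoord_mem_target I G)).continuousAt.eventually_mem
      (by simpa using hN)
  obtain ⟨r, hr, hball⟩ := Metric.nhds_basis_closedBall.mem_iff.1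
    (inter_mem (inter_mem hs (unitChart_target_mem_nhds I G)) hsymm)
  refine ⟨r, hr, fun y hy => (hball hy).1, ?_⟩
  have himage : (unitChart I G).symm '' Metric.closedBall (unitCoord I G) r =
      N ∩ unitChart I G ⁻¹' Metric.closedBall (unitCoord I G) r := by
    ext x
    constructor
    · rintro ⟨y, hy, rfl⟩
      refine ⟨(hball hy).2, ?_⟩
      rwa [mem_preimage, (unitChart I G).right_inv (hball hy).1.2]
    · rintro ⟨hxN, hx⟩
      exact ⟨_, hx, (unitChart I G).left_inv (hNsource hxN)⟩
  rw [himage]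
  exact ContinuousOn.preimage_isClosed_of_isClosed
    (fun x hx => (contMDiffAt_unitChart (hNsource hx)).continuousAt.continuousWithinAt) hNclosed
    Metric.isClosed_closedBall

theorem exists_forall_mem_of_norm_leftLogDeriv_le {U : Set G} (hU : U ∈ 𝓝 (1 : G)) {T : ℝ}
    (hT : 0 ≤ T) : ∃ δ > 0, ∀ (γ : ℝ → G) (c : ℝ → E), γ 0 = 1 →
      (∀ θ ∈ Icc 0 T, HasLeftLogDerivAt I γ (c θ) θ) → (∀ θ ∈ Icc 0 T, ‖c θ‖ ≤ δ) →
      ∀ θ ∈ Icc 0 T, γ θ ∈ U := by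
  set φ := unitChart I G
  set C : ℝ := ‖leftTransDeriv I (φ.symm (unitCoord I G))‖ + 1
  have hC : 0 < C := by positivity
  have hnhds : {y | ‖leftTransDeriv I (φ.symm y)‖ < C ∧ φ.symm y ∈ U} ∈ 𝓝 (unitCoord I G) :=
    ((contDiffAt_leftTransDeriv_unitChart_symm
      (unitCoord_mem_target I G)).continuousAt.norm.eventually (gt_mem_nhds (lt_add_one _))).and
      ((contMDiffAt_unitChart_symm (unitCoord_mem_target I G)).continuousAt.eventually_mem
        (by simpa using hU))
  obtain ⟨r, hr, hball, hclosed⟩ := exists_isClosed_unitChart_symm_image_closedBall hnhds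
  set V : Set G := φ.symm '' Metric.closedBall (unitCoord I G) r
  have hV : ∀ x ∈ V, x ∈ φ.source ∧ ‖leftTransDeriv I x‖ ≤ C ∧ x ∈ U := by
    rintro _ ⟨y, hy, rfl⟩
    exact ⟨φ.map_target (hball hy).2, (hball hy).1.1.le, (hball hy).1.2⟩
  have hmemV : ∀ x ∈ φ.source, φ x ∈ Metric.closedBall (unitCoord I G) r → x ∈ V :=
    fun x hx hy => ⟨φ x, hy, φ.left_inv hx⟩
  refine ⟨r / (C * (T + 1)), by positivity, fun γ c h0 hγ hc => ?_⟩
  have hderiv : ∀ θ ∈ Icc 0 T ∩ γ ⁻¹' V,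
      HasDerivAt (fun τ => φ (γ τ)) (leftTransDeriv I (γ θ) (c θ)) θ :=
    fun θ hθ => (hγ θ hθ.1).hasDerivAt_unitChart (hV _ hθ.2).1
  refine fun θ hθ => (hV _ (Icc_subset_of_norm_deriv_le (S := γ ⁻¹' V) (r := r)
    (C := C * (r / (C * (T + 1)))) ?_ ?_ hderiv (fun θ hθ => ?_) (fun θ hθ hlt => ?_) hr ?_ hθ)).2.2
  · exact ContinuousOn.preimage_isClosed_of_isClosed
      (fun θ hθ => (hγ θ hθ).1.continuousWithinAt) isClosed_Icc hclosed
  · rw [mem_preimage, h0]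
    exact hmemV 1 (one_mem_unitChart_source I G) (Metric.mem_closedBall_self hr.le)
  · exact ((leftTransDeriv I (γ θ)).le_opNorm _).trans
      (mul_le_mul (hV _ hθ.2).2.1 (hc θ hθ.1) (norm_nonneg _) hC.le)
  · rw [h0, ← dist_eq_norm] at hlt
    filter_upwards [(hγ θ hθ.1).1.eventually_mem
      ((isOpen_unitChart_source I G).mem_nhds (hV _ hθ.2).1),
      (hderiv θ hθ).continuousAt.eventually_mem (Metric.isOpen_ball.mem_nhds hlt)] with τ h1 h2
    exact hmemV _ h1 (Metric.ball_subset_closedBall h2)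
  · rw [show C * (r / (C * (T + 1))) = r / (T + 1) by field_simp, div_mul_eq_mul_div,
      div_lt_iff₀ (by positivity)]
    linarith

theorem exists_forall_mem_of_norm_leftLogDeriv_le_symm {U : Set G} (hU : U ∈ 𝓝 (1 : G)) {T : ℝ}
    (hT : 0 ≤ T) : ∃ δ > 0, ∀ (γ : ℝ → G) (c : ℝ → E), γ 0 = 1 →
      (∀ θ, HasLeftLogDerivAt I γ (c θ) θ) → (∀ θ ∈ Icc (-T) T, ‖c θ‖ ≤ δ) →
      ∀ θ ∈ Icc (-T) T, γ θ ∈ U := by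
  obtain ⟨δ, hδ, hδU⟩ := exists_forall_mem_of_norm_leftLogDeriv_le (I := I) hU hT
  refine ⟨δ, hδ, fun γ c h0 hγ hc θ hθ => ?_⟩
  rcases le_total 0 θ with hpos | hneg
  · exact hδU γ c h0 (fun τ _ => hγ τ) (fun τ hτ => hc τ ⟨by linarith [hτ.1], hτ.2⟩) θ
      ⟨hpos, hθ.2⟩
  · have hrev := hδU (fun τ => γ (-τ)) (fun τ => (-1 : ℝ) • c (-τ)) (by simp [h0])
      (fun τ _ => (hγ (-τ)).comp_hasDerivAt (hasDerivAt_neg τ))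
      (fun τ hτ => by simpa using hc (-τ) ⟨by linarith [hτ.2], by linarith [hτ.1]⟩)
      (-θ) ⟨by linarith, by linarith [hθ.1]⟩
    simpa using hrev

theorem tendsto_one_of_hasLeftLogDerivAt {X : Type*} [TopologicalSpace X] {c : X → ℝ → E}
    (hc : Continuous fun p : X × ℝ => c p.1 p.2) {γ : X → ℝ → G} (h0 : ∀ x, γ x 0 = 1)
    (h : ∀ x θ, HasLeftLogDerivAt I (γ x) (c x θ) θ) {x₀ : X} (hx₀ : c x₀ = 0) (θ₀ : ℝ) :
    Tendsto (fun p : X × ℝ => γ p.1 p.2) (𝓝 (x₀, θ₀)) (𝓝 1) := by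
  intro U hU
  obtain ⟨δ, hδ, hδU⟩ := exists_forall_mem_of_norm_leftLogDeriv_le_symm (I := I) hU
    (T := |θ₀| + 1) (by positivity)
  have hsmall : ∀ᶠ x in 𝓝 x₀, ∀ τ ∈ Icc (-(|θ₀| + 1)) (|θ₀| + 1), ‖c x τ‖ ≤ δ := by
    refine isCompact_Icc.eventually_forall_of_forall_eventually fun τ _ => ?_
    have hlt : ‖c x₀ τ‖ < δ := by simpa [hx₀] using hδ
    exact (hc.norm.continuousAt (x := (x₀, τ)).eventually (gt_mem_nhds hlt)).mono
      fun p hp => le_of_lt hp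
  have hθ₀ : ∀ᶠ θ in 𝓝 θ₀, θ ∈ Icc (-(|θ₀| + 1)) (|θ₀| + 1) :=
    ((continuous_abs.tendsto θ₀).eventually (gt_mem_nhds (lt_add_one |θ₀|))).mono
      fun θ hθ => abs_le.1 (le_of_lt hθ)
  rw [mem_map]
  filter_upwards [hsmall.prod_inl_nhds θ₀, hθ₀.prod_inr_nhds x₀] with p hp hpθ
  exact hδU (γ p.1) (c p.1) (h0 _) (h _) hp p.2 hpθ

/-- With `γ₀` the curve at the base parameter, `γ γ₀⁻¹` has a log-derivative vanishing there. -/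
theorem continuous_uncurry_of_hasLeftLogDerivAt {X : Type*} [TopologicalSpace X] {c : X → ℝ → E}
    (hc : Continuous fun p : X × ℝ => c p.1 p.2) {γ : X → ℝ → G} (h0 : ∀ x, γ x 0 = 1)
    (h : ∀ x θ, HasLeftLogDerivAt I (γ x) (c x θ) θ) :
    Continuous fun p : X × ℝ => γ p.1 p.2 := by
  have := topologicalGroup_of_lieGroup I ∞ (G := G)
  refine continuous_iff_continuousAt.2 fun ⟨x₀, θ₀⟩ => ?_
  have hγ₀ : Continuous (γ x₀) := continuous_iff_continuousAt.2 fun θ => (h x₀ θ).1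
  have hd : Continuous fun p : X × ℝ =>
      adjointCLM I (γ x₀ p.2) (c p.1 p.2 - c x₀ p.2) :=
    (contMDiff_adjointCLM.continuous.comp (hγ₀.comp continuous_snd)).clm_apply
      (hc.sub (hc.comp (continuous_const.prodMk continuous_snd)))
  have hdiv : Tendsto (fun p : X × ℝ => γ p.1 p.2 * (γ x₀ p.2)⁻¹) (𝓝 (x₀, θ₀)) (𝓝 1) :=
    tendsto_one_of_hasLeftLogDerivAt (c := fun x τ => adjointCLM I (γ x₀ τ) (c x τ - c x₀ τ))
      (γ := fun x τ => γ x τ * (γ x₀ τ)⁻¹) hd (fun x => by simp [h0])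
      (fun x θ => by simpa [sub_eq_add_neg] using (h x θ).mul (h x₀ θ).inv)
      (funext fun τ => by simp) θ₀
  simpa [ContinuousAt] using hdiv.mul ((hγ₀.comp continuous_snd).tendsto (x₀, θ₀))

end ContinuousDependence

/-! ### Connections over the circle -/

section Circle

theorem contMDiff_circle_coe : ContMDiff (𝓡 1) 𝓘(ℝ, ℂ) ∞ (fun z : Circle => (z : ℂ)) := by
  have := finrank_real_complex_fact'
  exact contMDiff_coe_sphere

theorem mdifferentiableAt_circleExp (θ : ℝ) : MDifferentiableAt 𝓘(ℝ, ℝ) (𝓡 1) Circle.exp θ :=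
  (contMDiff_circleExp (m := 1)).mdifferentiableAt one_ne_zero

theorem hasDerivAt_coe_circleExp (θ : ℝ) :
    HasDerivAt (fun τ : ℝ => (Circle.exp τ : ℂ)) (Circle.exp θ * Complex.I) θ := by
  simpa using (Complex.ofRealCLM.hasDerivAt.mul_const Complex.I).cexp

/-- The invariant one-form `dθ = Im (z⁻¹ dz)` of the circle. -/
def circleAngleForm (z : Circle) : EuclideanSpace ℝ (Fin 1) →L[ℝ] ℝ :=
  (Complex.imCLM.comp (ContinuousLinearMap.mul ℝ ℂ ((z⁻¹ : Circle) : ℂ))).comp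
    (mfderiv (𝓡 1) 𝓘(ℝ, ℂ) (fun w : Circle => (w : ℂ)) z)

theorem contMDiff_circleAngleForm : ContMDiff (𝓡 1).tangent 𝓘(ℝ, ℝ) ∞
    (fun v : TangentBundle (𝓡 1) Circle => circleAngleForm v.1 v.2) := by
  have hinv : ContMDiff (𝓡 1).tangent 𝓘(ℝ, ℂ) ∞
      (fun v : TangentBundle (𝓡 1) Circle => ((v.1⁻¹ : Circle) : ℂ)) :=
    contMDiff_circle_coe.comp (Bundle.contMDiff_proj _).inv
  have hcoe := (contMDiff_snd_tangentBundle_modelSpace ℂ 𝓘(ℝ, ℂ)).comp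
    (contMDiff_circle_coe.contMDiff_tangentMap (m := ∞) le_rfl)
  have him : ContDiff ℝ ∞ (fun w : ℂ × ℂ => (w.1 * w.2).im) :=
    Complex.imCLM.contDiff.comp contDiff_mul
  exact him.contMDiff.comp (hinv.prodMk_space hcoe)

theorem circleAngleForm_mfderiv_circleExp (θ s : ℝ) :
    circleAngleForm (Circle.exp θ) (mfderiv 𝓘(ℝ, ℝ) (𝓡 1) Circle.exp θ s) = s := by
  have hchain := mfderiv_comp_apply (I := 𝓘(ℝ, ℝ)) (I' := 𝓡 1) (I'' := 𝓘(ℝ, ℂ)) θ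
    (contMDiff_circle_coe.mdifferentiableAt (by simp)) (mdifferentiableAt_circleExp θ) s
  have hderiv := (hasDerivAt_coe_circleExp θ).hasFDerivAt.hasMFDerivAt.mfderiv
  have hvel := hchain.symm.trans (DFunLike.congr_fun hderiv s)
  refine (congrArg (fun w : ℂ => (((Circle.exp θ)⁻¹ : Circle) * w : ℂ).im) hvel).trans ?_
  change ((((Circle.exp θ)⁻¹ : Circle) : ℂ) * (s • (Circle.exp θ * Complex.I))).im = s
  rw [mul_smul_comm, ← mul_assoc, ← Circle.coe_mul, inv_mul_cancel, Circle.coe_one]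
  simp

theorem surjective_mfderiv_circleExp (θ : ℝ) :
    Function.Surjective (mfderiv 𝓘(ℝ, ℝ) (𝓡 1) Circle.exp θ) := by
  let d : ℝ →ₗ[ℝ] EuclideanSpace ℝ (Fin 1) := (mfderiv 𝓘(ℝ, ℝ) (𝓡 1) Circle.exp θ).toLinearMap
  have hd : Function.Injective d :=
    Function.LeftInverse.injective (g := circleAngleForm (Circle.exp θ))
      (circleAngleForm_mfderiv_circleExp θ)
  exact (LinearMap.injective_iff_surjective_of_finrank_eq_finrank (f := d) (by simp)).1 hd

variable {E : Type*} [NormedAddCommGroup E] [NormedSpace ℝ E]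
  {H : Type*} [TopologicalSpace H] {I : ModelWithCorners ℝ E H}
  {M : Type*} [TopologicalSpace M] [ChartedSpace H M]

theorem contMDiff_comp_circleExp (f : C^∞⟮𝓡 1, Circle; I, M⟯) :
    ContMDiff 𝓘(ℝ, ℝ) I ∞ (fun τ => f (Circle.exp τ)) :=
  f.contMDiff.comp contMDiff_circleExp

theorem contMDiff_of_comp_circleExp {f : Circle → M}
    (hf : ContMDiff 𝓘(ℝ, ℝ) I ∞ (f ∘ Circle.exp)) : ContMDiff (𝓡 1) I ∞ f := by
  intro z₀
  let localArg : Circle → ℝ := fun z =>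
    Complex.arg z₀ + (Complex.log ((z : ℂ) * (z₀⁻¹ : Circle))).im
  have exp_localArg (z : Circle) : Circle.exp (localArg z) = z := by
    rw [Circle.exp_add, Circle.exp_arg, ← Circle.coe_mul, Complex.log_im, Circle.exp_arg,
      mul_comm z, mul_inv_cancel_left]
  have hlog : ContDiffAt ℝ ∞ Complex.log ((z₀ : ℂ) * (z₀⁻¹ : Circle)) := by
    rw [← Circle.coe_mul, mul_inv_cancel, Circle.coe_one]
    exact (Complex.contDiffAt_log (by simp)).restrict_scalars ℝ
  have hlogMul : ContDiffAt ℝ ∞ (fun w : ℂ => Complex.log (w * (z₀⁻¹ : Circle))) (z₀ : ℂ) :=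
    ContDiffAt.comp (z₀ : ℂ) hlog (contDiffAt_id.mul contDiffAt_const)
  have hlocalArg : ContMDiffAt (𝓡 1) 𝓘(ℝ, ℝ) ∞ localArg z₀ :=
    (contDiffAt_const.add
      (Complex.imCLM.contDiff.contDiffAt.comp (z₀ : ℂ) hlogMul)).contMDiffAt.comp z₀
        contMDiff_circle_coe.contMDiffAt
  refine (hf.contMDiffAt.comp z₀ hlocalArg).congr_of_eventuallyEq (Eventually.of_forall fun z => ?_)
  simp only [Function.comp_apply, exp_localArg]

theorem apply_arg_circleExp {α : Type*} {γ : ℝ → α} (hp : Function.Periodic γ (2 * Real.pi))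
    (θ : ℝ) : γ (Complex.arg (Circle.exp θ)) = γ θ := by
  obtain ⟨m, hm⟩ := Circle.exp_eq_exp.1 (Circle.exp_arg (Circle.exp θ))
  rw [hm]
  exact hp.int_mul m θ

/-- The loop obtained from a smooth `2π`-periodic curve. -/
def loopOfPeriodic (γ : ℝ → M) (hγ : ContMDiff 𝓘(ℝ, ℝ) I ∞ γ)
    (hp : Function.Periodic γ (2 * Real.pi)) : C^∞⟮𝓡 1, Circle; I, M⟯ where
  val z := γ (Complex.arg z)
  property := contMDiff_of_comp_circleExp (hγ.congr (apply_arg_circleExp hp))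

@[simp]
theorem loopOfPeriodic_circleExp {γ : ℝ → M} (hγ : ContMDiff 𝓘(ℝ, ℝ) I ∞ γ)
    (hp : Function.Periodic γ (2 * Real.pi)) (θ : ℝ) :
    loopOfPeriodic γ hγ hp (Circle.exp θ) = γ θ :=
  apply_arg_circleExp hp θ

end Circle

section MaurerCartan

theorem contMDiff_mfderiv_of_apply_diag_eq {F H M F' H' N : Type*}
    [NormedAddCommGroup F] [NormedSpace ℝ F] [TopologicalSpace H] {J : ModelWithCorners ℝ F H}
    [TopologicalSpace M] [ChartedSpace H M] [IsManifold J ∞ M]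
    [NormedAddCommGroup F'] [NormedSpace ℝ F'] [TopologicalSpace H'] {J' : ModelWithCorners ℝ F' H'}
    [TopologicalSpace N] [ChartedSpace H' N] [IsManifold J' ∞ N]
    {μ : M × M → N} (hμ : ContMDiff (J.prod J) J' ∞ μ) {y : N} (hdiag : ∀ x, μ (x, x) = y) :
    ContMDiff J.tangent 𝓘(ℝ, F') ∞
      (fun v : TangentBundle J M => (mfderiv J J' (fun x => μ (v.1, x)) v.1 v.2 : F')) := by
  have : IsManifold J 1 M := .of_le (n := ∞) (by simp)
  have : IsManifold J' 1 N := .of_le (n := ∞) (by simp)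
  let secondFactor (v : TangentBundle J M) : TangentBundle (J.prod J) (M × M) :=
    (equivTangentBundleProd J M J M).symm (⟨v.1, 0⟩, v)
  have hsecond : ContMDiff J.tangent (J.prod J).tangent ∞ secondFactor :=
    contMDiff_equivTangentBundleProd_symm.comp
      (((Bundle.contMDiff_zeroSection ℝ (TangentSpace J : M → Type _)).comp
        (Bundle.contMDiff_proj _)).prodMk contMDiff_id)
  have hS : ContMDiff J.tangent J'.tangent ∞
      (fun v : TangentBundle J M => tangentMap (J.prod J) J' μ (secondFactor v)) :=
    (hμ.contMDiff_tangentMap (m := ∞) le_rfl).comp hsecond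
  have hval (v : TangentBundle J M) : tangentMap (J.prod J) J' μ (secondFactor v) =
      ⟨y, (mfderiv J J' (fun x => μ (v.1, x)) v.1 v.2 : F')⟩ := by
    have hpartial := mfderiv_prod_eq_add_apply (I := J) (I' := J) (I'' := J') (p := (v.1, v.1))
      (v := ((0 : F), (v.2 : F))) (hμ.mdifferentiableAt (by simp))
    refine Bundle.TotalSpace.ext (hdiag v.1) (heq_of_eq ?_)
    exact hpartial.trans ((congrArg (· + _) (map_zero _)).trans (zero_add (M := F') _))
  intro v₀
  refine (Bundle.contMDiffAt_totalSpace.1 (hS v₀)).2.congr_of_eventuallyEq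
    (Eventually.of_forall fun v => ?_)
  simp only [hval]
  exact ((tangentBundleCore J' N).coordChange_self (achart H' y) y (mem_achart_source H' y) _).symm

variable {E : Type*} [NormedAddCommGroup E] [NormedSpace ℝ E]
  {H : Type*} [TopologicalSpace H] (I : ModelWithCorners ℝ E H)
  {G : Type*} [TopologicalSpace G] [ChartedSpace H G] [Group G]

/-- The left Maurer–Cartan form `x⁻¹ dx` of `G`. -/
def maurerCartan (x : G) : TangentSpace I x →L[ℝ] E := mfderiv I I (fun y : G => x⁻¹ * y) x

variable {I} [LieGroup I ∞ G]

theorem mdifferentiableAt_const_mul (g x : G) : MDifferentiableAt I I (fun y : G => g * y) x :=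
  (contMDiff_mul_left (I := I) (n := ∞)).mdifferentiableAt (by simp)

theorem mdifferentiableAt_mul_const (g x : G) : MDifferentiableAt I I (fun y : G => y * g) x :=
  (contMDiff_mul_right (I := I) (n := ∞)).mdifferentiableAt (by simp)

theorem contMDiff_maurerCartan : ContMDiff I.tangent 𝓘(ℝ, E) ∞
    (fun v : TangentBundle I G => maurerCartan I v.1 v.2) :=
  contMDiff_mfderiv_of_apply_diag_eq (J := I) (J' := I) (μ := fun q : G × G => q.1⁻¹ * q.2)
    (contMDiff_fst.inv.mul contMDiff_snd) (y := 1) fun x => inv_mul_cancel x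

theorem maurerCartan_mfderiv {F' H' M : Type*} [NormedAddCommGroup F'] [NormedSpace ℝ F']
    [TopologicalSpace H'] {J : ModelWithCorners ℝ F' H'} [TopologicalSpace M] [ChartedSpace H' M]
    {f : M → G} {x : M} (hf : MDifferentiableAt J I f x) (v : TangentSpace J x) :
    maurerCartan I (f x) (mfderiv J I f x v) = (mfderiv J I (fun y => (f x)⁻¹ * f y) x v : E) :=
  (mfderiv_comp_apply x (mdifferentiableAt_const_mul (f x)⁻¹ (f x)) hf v).symm

theorem maurerCartan_mfderiv_const_mul (g : G) (X : GroupLieAlgebra I G) :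
    maurerCartan I (g * 1) (mfderiv I I (fun x : G => g * x) 1 X) = X := by
  have hid : (fun x : G => (g * 1)⁻¹ * (g * x)) = id := by ext; simp
  rw [maurerCartan_mfderiv (mdifferentiableAt_const_mul g 1), hid]
  exact DFunLike.congr_fun mfderiv_id X

theorem mfderiv_const_mul_maurerCartan (x : G) (w : TangentSpace I x) :
    (mfderiv I I (fun y : G => x * y) 1 (maurerCartan I x w) : E) = w := by
  have hchain := mfderiv_comp_apply_of_eq (I := I) (I' := I) (I'' := I) (x := x)
    (mdifferentiableAt_const_mul x 1) (mdifferentiableAt_const_mul x⁻¹ x) (inv_mul_cancel x) w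
  have hid : (fun y : G => x * y) ∘ (fun y : G => x⁻¹ * y) = id := by ext; simp
  rw [hid, mfderiv_id] at hchain
  exact hchain.symm

theorem maurerCartan_mfderiv_mul_const (g x : G) (w : TangentSpace I x) :
    maurerCartan I (x * g) (mfderiv I I (fun y : G => y * g) x w) =
      adjointCLM I g⁻¹ (maurerCartan I x w) := by
  rw [maurerCartan_mfderiv (mdifferentiableAt_mul_const g x)]
  have hchain := mfderiv_comp_apply_of_eq (I := I) (I' := I) (I'' := I) (x := x)
    ((contMDiff_conj (I := I) g⁻¹).mdifferentiableAt (by simp))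
    (mdifferentiableAt_const_mul x⁻¹ x) (inv_mul_cancel x) w
  have hconj : (fun y : G => (x * g)⁻¹ * (y * g)) =
      (fun y : G => g⁻¹ * y * g⁻¹⁻¹) ∘ fun y : G => x⁻¹ * y := by ext; simp [mul_assoc]
  rw [hconj]
  exact hchain

end MaurerCartan

section Connections

variable {E : Type*} [NormedAddCommGroup E] [NormedSpace ℝ E]
  {H : Type*} [TopologicalSpace H] {I : ModelWithCorners ℝ E H}
  {G : Type*} [TopologicalSpace G] [ChartedSpace H G] [Group G] [LieGroup I ∞ G]

namespace CircleConnection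

/-- The pullback `σ^* A` of a connection along the section `σ z = (z, 1)`. -/
def sectionForm (A : CircleConnection I G) (z : Circle) : TangentSpace (𝓡 1) z →L[ℝ] E :=
  (A.form (z, 1)).comp (mfderiv (𝓡 1) ((𝓡 1).prod I) (fun y : Circle => (y, (1 : G))) z)

theorem form_horizontal (A : CircleConnection I G) (z : Circle) (x : G)
    (a : TangentSpace (𝓡 1) z) :
    A.form (z, x) (a, 0) = adjointCLM I x⁻¹ (A.sectionForm z a) := by
  have hchain := mfderiv_comp_apply (I := 𝓡 1) (I' := (𝓡 1).prod I) (I'' := (𝓡 1).prod I) z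
    (g := fun q : Circle × G => (q.1, q.2 * x)) (f := fun y : Circle => (y, (1 : G)))
    (mdifferentiableAt_fst.prodMk
      ((mdifferentiableAt_mul_const x 1).comp (z, (1 : G)) mdifferentiableAt_snd))
    (mdifferentiableAt_id.prodMk mdifferentiableAt_const) a
  have h : A.form (z, 1 * x)
      (mfderiv (𝓡 1) ((𝓡 1).prod I) (fun y : Circle => (y, 1 * x)) z a) =
      adjointCLM I x⁻¹ (A.sectionForm z a) :=
    (congrArg (A.form (z, 1 * x)) hchain).trans (A.equivariant x (z, 1) _)
  rw [one_mul, mfderiv_prod_left] at h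
  exact h

theorem form_vertical (A : CircleConnection I G) (z : Circle) (x : G) (w : TangentSpace I x) :
    A.form (z, x) (0, w) = maurerCartan I x w := by
  have hchain := mfderiv_comp_apply_of_eq (I := I) (I' := I) (I'' := (𝓡 1).prod I) (x := 1)
    (g := fun y : G => (z, y)) (f := fun y : G => x * y)
    (mdifferentiableAt_const.prodMk mdifferentiableAt_id) (mdifferentiableAt_const_mul x 1)
    (mul_one x) (maurerCartan I x w)
  rw [mfderiv_prod_right, mfderiv_const_mul_maurerCartan] at hchain
  have h := A.vertical (z, x) (maurerCartan I x w)
  rw [mul_one] at h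
  exact (congrArg (A.form (z, x)) hchain.symm).trans h

theorem form_apply (A : CircleConnection I G) (z : Circle) (x : G)
    (a : TangentSpace (𝓡 1) z) (w : TangentSpace I x) :
    A.form (z, x) (a, w) =
      adjointCLM I x⁻¹ (A.sectionForm z a) + maurerCartan I x w := by
  rw [← form_horizontal, ← A.form_vertical z]
  refine Eq.trans (congrArg _ ?_) (map_add _ _ _)
  exact Prod.ext (add_zero _).symm (zero_add _).symm

theorem sectionForm_mfderiv_circleExp (A : CircleConnection I G) (θ s : ℝ) :
    A.sectionForm (Circle.exp θ) (mfderiv 𝓘(ℝ, ℝ) (𝓡 1) Circle.exp θ s) = s • A.coeff θ := by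
  have hchain := mfderiv_comp_apply (I' := 𝓡 1) (I'' := (𝓡 1).prod I) θ
    (g := fun y : Circle => (y, (1 : G)))
    (mdifferentiableAt_id.prodMk mdifferentiableAt_const) (mdifferentiableAt_circleExp θ) (1 : ℝ)
  have hcoeff : A.coeff θ =
      A.sectionForm (Circle.exp θ) (mfderiv 𝓘(ℝ, ℝ) (𝓡 1) Circle.exp θ (1 : ℝ)) :=
    congrArg (A.form (Circle.exp θ, 1)) hchain
  have hsmul : mfderiv 𝓘(ℝ, ℝ) (𝓡 1) Circle.exp θ s =
      s • mfderiv 𝓘(ℝ, ℝ) (𝓡 1) Circle.exp θ (1 : ℝ) :=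
    (congrArg _ (mul_one s).symm).trans (map_smul _ s (1 : ℝ))
  rw [hcoeff, hsmul, map_smul]

theorem ext_coeff {A B : CircleConnection I G} (h : ∀ θ, A.coeff θ = B.coeff θ) : A = B := by
  ext ⟨z, x⟩ ⟨a, w⟩
  obtain ⟨θ, rfl⟩ : ∃ θ, Circle.exp θ = z := ⟨_, Circle.exp_arg z⟩
  obtain ⟨s, rfl⟩ := surjective_mfderiv_circleExp θ a
  have hsection := (A.sectionForm_mfderiv_circleExp θ s).trans
    ((congrArg (HSMul.hSMul (α := ℝ) s) (h θ)).trans (B.sectionForm_mfderiv_circleExp θ s).symm)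
  refine (A.form_apply _ x _ w).trans (Eq.trans ?_ (B.form_apply _ x _ w).symm)
  rw [hsection]

theorem contDiff_coeff (A : CircleConnection I G) : ContDiff ℝ ∞ A.coeff := by
  have hunit : ContMDiff 𝓘(ℝ, ℝ) 𝓘(ℝ, ℝ).tangent ∞
      (fun θ : ℝ => (⟨θ, (1 : ℝ)⟩ : TangentBundle 𝓘(ℝ, ℝ) ℝ)) :=
    contMDiff_vectorSpace_iff_contDiff.2 contDiff_const
  have hsection : ContMDiff 𝓘(ℝ, ℝ) ((𝓡 1).prod I) ∞ (fun τ : ℝ => (Circle.exp τ, (1 : G))) :=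
    contMDiff_circleExp.prodMk contMDiff_const
  exact (A.smooth.comp ((hsection.contMDiff_tangentMap (m := ∞) le_rfl).comp hunit)).contDiff

theorem coeff_periodic (A : CircleConnection I G) :
    Function.Periodic A.coeff (2 * Real.pi) := by
  intro θ
  let σ (τ : ℝ) : Circle × G := (Circle.exp τ, 1)
  let shift (τ : ℝ) : ℝ := τ + 2 * Real.pi
  have hσ (τ : ℝ) : MDifferentiableAt 𝓘(ℝ, ℝ) ((𝓡 1).prod I) σ τ :=
    (mdifferentiableAt_circleExp τ).prodMk mdifferentiableAt_const
  have hshift : HasDerivAt shift 1 θ := (hasDerivAt_id θ).add_const _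
  have hderiv : mfderiv 𝓘(ℝ, ℝ) 𝓘(ℝ, ℝ) shift θ (1 : ℝ) = (1 : ℝ) := by
    rw [mfderiv_eq_fderiv]
    exact hshift.hasFDerivAt.fderiv ▸ one_smul ℝ (1 : ℝ)
  have hchain := mfderiv_comp_apply θ (hσ (shift θ)) hshift.differentiableAt.mdifferentiableAt
    (1 : ℝ)
  rw [hderiv] at hchain
  have hcoeff : A.form ((σ ∘ shift) θ)
      (mfderiv 𝓘(ℝ, ℝ) ((𝓡 1).prod I) (σ ∘ shift) θ (1 : ℝ)) = A.coeff (shift θ) :=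
    congrArg (A.form _) hchain
  have hperiodic : σ ∘ shift = σ := funext fun τ => Prod.ext (Circle.periodic_exp τ) rfl
  rw [hperiodic] at hcoeff
  exact hcoeff.symm

theorem form_mfderiv_circleExp_prodMk [I.Boundaryless] (A : CircleConnection I G) {u : ℝ → G}
    {ξ : E} {θ : ℝ} (hu : MDifferentiableAt 𝓘(ℝ, ℝ) I u θ) (hξ : HasLeftLogDerivAt I u ξ θ) :
    A.form (Circle.exp θ, u θ)
      (mfderiv 𝓘(ℝ, ℝ) ((𝓡 1).prod I) (fun τ : ℝ => (Circle.exp τ, u τ)) θ (1 : ℝ)) =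
      adjointCLM I (u θ)⁻¹ (A.coeff θ) + ξ := by
  have hmc : maurerCartan I (u θ) (mfderiv 𝓘(ℝ, ℝ) I u θ (1 : ℝ)) = ξ :=
    (maurerCartan_mfderiv hu _).trans ((hasLeftLogDerivAt_mfderiv hu).unique hξ)
  have hcoeff := (A.sectionForm_mfderiv_circleExp θ 1).trans (one_smul ℝ _)
  rw [mfderiv_prodMk (mdifferentiableAt_circleExp θ) hu, ← hcoeff, ← hmc]
  exact A.form_apply _ _ _ _

end CircleConnection

namespace SmoothLoop

theorem hasLeftLogDerivAt (g : SmoothLoop I G) (θ : ℝ) :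
    HasLeftLogDerivAt I (fun τ => g (Circle.exp τ)) (g.logDeriv θ) θ :=
  hasLeftLogDerivAt_mfderiv ((contMDiff_comp_circleExp g).mdifferentiableAt (by simp))

theorem logDeriv_periodic (g : SmoothLoop I G) : Function.Periodic g.logDeriv (2 * Real.pi) := by
  intro θ
  have h := (g.hasLeftLogDerivAt (θ + 2 * Real.pi)).comp_hasDerivAt (f := fun τ => τ + 2 * Real.pi)
    ((hasDerivAt_id θ).add_const _)
  simp only [Circle.periodic_exp _, one_smul] at h
  exact h.unique (g.hasLeftLogDerivAt θ)

theorem contDiff_logDeriv [I.Boundaryless] (g : SmoothLoop I G) : ContDiff ℝ ∞ g.logDeriv :=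
  contDiff_of_hasLeftLogDerivAt (contMDiff_comp_circleExp g) g.hasLeftLogDerivAt

end SmoothLoop

namespace CircleConnection

theorem coeff_pullback [I.Boundaryless] (A : CircleConnection I G) (g : SmoothLoop I G) (θ : ℝ) :
    (A.pullback g).coeff θ =
      adjointCLM I (g (Circle.exp θ))⁻¹ (A.coeff θ) + g.logDeriv θ := by
  have hsection : MDifferentiableAt 𝓘(ℝ, ℝ) ((𝓡 1).prod I)
      (fun τ : ℝ => (Circle.exp τ, (1 : G))) θ :=
    (mdifferentiableAt_circleExp θ).prodMk mdifferentiableAt_const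
  have hchain := mfderiv_comp_apply θ (g.contMDiff_gauge.mdifferentiableAt (by simp)) hsection
    (1 : ℝ)
  have hu : MDifferentiableAt 𝓘(ℝ, ℝ) I (fun τ => g (Circle.exp τ) * 1) θ := by
    simpa only [mul_one] using (contMDiff_comp_circleExp g).mdifferentiableAt (by simp)
  have h := A.form_mfderiv_circleExp_prodMk hu (ξ := g.logDeriv θ)
    (by simpa only [mul_one] using g.hasLeftLogDerivAt θ)
  refine (congrArg (A.form _) hchain.symm).trans (h.trans ?_)
  rw [mul_one]

end CircleConnection

section OfLoop

theorem mfderiv_fst_mul_const (g : G) (p : Circle × G) (v : TangentSpace ((𝓡 1).prod I) p) :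
    mfderiv ((𝓡 1).prod I) ((𝓡 1).prod I) (fun q : Circle × G => (q.1, q.2 * g)) p v =
      (v.1, mfderiv I I (fun y : G => y * g) p.2 v.2) := by
  have h := mfderiv_prodMap (I := 𝓡 1) (I' := I) (J := 𝓡 1) (J' := I) (p := p)
    (f := (id : Circle → Circle)) mdifferentiableAt_id (mdifferentiableAt_mul_const g p.2)
  rw [mfderiv_id] at h
  exact DFunLike.congr_fun h v

theorem mfderiv_prodMk_const_mul (z : Circle) (g : G) (X : GroupLieAlgebra I G) :
    (mfderiv I ((𝓡 1).prod I) (fun x : G => (z, g * x)) 1 X : EuclideanSpace ℝ (Fin 1) × E) =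
      (0, mfderiv I I (fun x : G => g * x) 1 X) := by
  rw [mfderiv_prodMk mdifferentiableAt_const (mdifferentiableAt_const_mul g 1), mfderiv_const]
  rfl

namespace CircleConnection

variable [I.Boundaryless]

/-- The connection `Ad(x⁻¹) f dθ + x⁻¹ dx`. -/
def ofLoop (f : C^∞⟮𝓡 1, Circle; 𝓘(ℝ, E), E⟯) : CircleConnection I G where
  form p := ((adjointCLM I p.2⁻¹).comp ((circleAngleForm p.1).smulRight (f p.1))).coprod
    (maurerCartan I p.2)
  smooth := by
    have hfst : ContMDiff ((𝓡 1).prod I).tangent (𝓡 1).tangent ∞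
        (fun v : TangentBundle ((𝓡 1).prod I) (Circle × G) =>
          (⟨v.1.1, v.2.1⟩ : TangentBundle (𝓡 1) Circle)) :=
      (contMDiff_fst.contMDiff_tangentMap le_rfl).congr fun _ => tangentMap_prodFst.symm
    have hsnd : ContMDiff ((𝓡 1).prod I).tangent I.tangent ∞
        (fun v : TangentBundle ((𝓡 1).prod I) (Circle × G) =>
          (⟨v.1.2, v.2.2⟩ : TangentBundle I G)) :=
      (contMDiff_snd.contMDiff_tangentMap le_rfl).congr fun _ => tangentMap_prodSnd.symm
    have hproj : ContMDiff ((𝓡 1).prod I).tangent ((𝓡 1).prod I) ∞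
        (fun v : TangentBundle ((𝓡 1).prod I) (Circle × G) => v.1) := Bundle.contMDiff_proj _
    have hAd := (contMDiff_adjointCLM (I := I) (G := G)).comp (contMDiff_snd.comp hproj).inv
    have hhor := (contMDiff_circleAngleForm.comp hfst).smul
      (f.contMDiff.comp (contMDiff_fst.comp hproj))
    exact (hAd.clm_apply hhor).add (contMDiff_maurerCartan.comp hsnd)
  vertical p X := by
    rw [mfderiv_prodMk_const_mul]
    refine Eq.trans ?_ (maurerCartan_mfderiv_const_mul p.2 X)
    have hhor : adjointCLM I (p.2 * 1)⁻¹
        (circleAngleForm p.1 (0 : EuclideanSpace ℝ (Fin 1)) • f p.1) = 0 := by simp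
    exact (congrArg (· + _) hhor).trans (zero_add (M := E) _)
  equivariant g p v := by
    rw [mfderiv_fst_mul_const]
    have hmc := maurerCartan_mfderiv_mul_const (I := I) g p.2 v.2
    refine (congrArg (_ + ·) hmc).trans ?_
    have hmul : adjointCLM I (p.2 * g)⁻¹ = (adjointCLM I g⁻¹).comp (adjointCLM I p.2⁻¹) := by
      rw [mul_inv_rev, adjointCLM_mul]
    refine Eq.trans ?_ (map_add (adjointCLM I g⁻¹) _ _).symm
    exact congrArg (· + _) (DFunLike.congr_fun hmul (circleAngleForm p.1 v.1 • f p.1))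

theorem coeff_ofLoop (f : C^∞⟮𝓡 1, Circle; 𝓘(ℝ, E), E⟯) (θ : ℝ) :
    (ofLoop f : CircleConnection I G).coeff θ = f (Circle.exp θ) := by
  have hmc : maurerCartan I (1 : G) (0 : TangentSpace I (1 : G)) = 0 := map_zero _
  rw [coeff, mfderiv_prodMk (mdifferentiableAt_circleExp θ) mdifferentiableAt_const, mfderiv_const]
  refine (congrArg (_ + ·) hmc).trans ((add_zero _).trans ?_)
  refine (congrArg (fun s : ℝ => adjointCLM I (1 : G)⁻¹ (s • f (Circle.exp θ)))
    (circleAngleForm_mfderiv_circleExp θ 1)).trans ?_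
  rw [one_smul, inv_one, adjointCLM_one, ContinuousLinearMap.id_apply]

theorem exists_coeff_eq {c : ℝ → E} (hc : ContDiff ℝ ∞ c)
    (hp : Function.Periodic c (2 * Real.pi)) : ∃ A : CircleConnection I G, A.coeff = c :=
  ⟨ofLoop (loopOfPeriodic c hc.contMDiff hp), funext fun θ => by
    rw [coeff_ofLoop, loopOfPeriodic_circleExp]⟩

end CircleConnection

end OfLoop

end Connections

/-! ### Families of smooth curves -/

section Families

variable {V W Z : Type*} [NormedAddCommGroup V] [NormedSpace ℝ V] [NormedAddCommGroup W]
  [NormedSpace ℝ W] [NormedAddCommGroup Z] [NormedSpace ℝ Z]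
  {X Y : Type*} [TopologicalSpace X] [TopologicalSpace Y]

/-- A family of smooth curves whose derivatives up to the order `n` are jointly continuous in the
parameter and the time. -/
def IsCkFamily (n : ℕ) (f : X → ℝ → V) : Prop :=
  (∀ x, ContDiff ℝ ∞ (f x)) ∧ ∀ k ≤ n, Continuous fun p : X × ℝ => iteratedDeriv k (f p.1) p.2

namespace IsCkFamily

variable {n : ℕ} {f : X → ℝ → V} {g : X → ℝ → W}

theorem continuous (h : IsCkFamily n f) : Continuous fun p : X × ℝ => f p.1 p.2 := by
  simpa only [iteratedDeriv_zero] using h.2 0 (Nat.zero_le n)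

theorem zero_iff : IsCkFamily 0 f ↔
    (∀ x, ContDiff ℝ ∞ (f x)) ∧ Continuous fun p : X × ℝ => f p.1 p.2 := by
  simp only [IsCkFamily, Nat.le_zero, forall_eq, iteratedDeriv_zero]

theorem of_le {m : ℕ} (h : IsCkFamily n f) (hm : m ≤ n) : IsCkFamily m f :=
  ⟨h.1, fun k hk => h.2 k (hk.trans hm)⟩

theorem succ_iff : IsCkFamily (n + 1) f ↔ (∀ x, ContDiff ℝ ∞ (f x)) ∧
    (Continuous fun p : X × ℝ => f p.1 p.2) ∧ IsCkFamily n fun x => deriv (f x) := by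
  refine ⟨fun h => ⟨h.1, h.continuous, fun x => (contDiff_infty_iff_deriv.1 (h.1 x)).2,
    fun k hk => ?_⟩, fun h => ⟨h.1, fun k hk => ?_⟩⟩
  · simpa only [iteratedDeriv_succ'] using h.2 (k + 1) (Nat.succ_le_succ hk)
  · cases k with
    | zero => simpa only [iteratedDeriv_zero] using h.2.1
    | succ k => simpa only [iteratedDeriv_succ'] using h.2.2.2 k (Nat.le_of_succ_le_succ hk)

theorem of_hasDerivAt {f' : X → ℝ → V} (hf : Continuous fun p : X × ℝ => f p.1 p.2)
    (hd : ∀ x θ, HasDerivAt (f x) (f' x θ) θ) (hf' : IsCkFamily n f') : IsCkFamily (n + 1) f := by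
  have deriv_eq : ∀ x, deriv (f x) = f' x := fun x => funext fun θ => (hd x θ).deriv
  refine succ_iff.2 ⟨fun x => contDiff_infty_iff_deriv.2
    ⟨fun θ => (hd x θ).differentiableAt, ?_⟩, hf, ?_⟩
  · rw [deriv_eq]; exact hf'.1 x
  · simpa only [deriv_eq] using hf'

theorem comp (h : IsCkFamily n f) {φ : Y → X} (hφ : Continuous φ) :
    IsCkFamily n fun y => f (φ y) :=
  ⟨fun y => h.1 (φ y), fun k hk =>
    (h.2 k hk).comp ((hφ.comp continuous_fst).prodMk continuous_snd)⟩

theorem const {f : ℝ → V} (h : ContDiff ℝ ∞ f) : IsCkFamily n fun _ : X => f :=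
  ⟨fun _ => h, fun k _ => (h.continuous_iteratedDeriv k (mod_cast le_top)).comp continuous_snd⟩

theorem of_continuous {f : X → V} (hf : Continuous f) : IsCkFamily n fun x (_ : ℝ) => f x := by
  refine ⟨fun x => contDiff_const, fun k _ => ?_⟩
  simp only [iteratedDeriv_const]
  split_ifs
  · exact hf.comp continuous_fst
  · exact continuous_const

theorem add {g : X → ℝ → V} (hf : IsCkFamily n f) (hg : IsCkFamily n g) :
    IsCkFamily n fun x θ => f x θ + g x θ := by
  refine ⟨fun x => (hf.1 x).add (hg.1 x), fun k hk => ?_⟩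
  refine ((hf.2 k hk).add (hg.2 k hk)).congr fun p => ?_
  exact (iteratedDeriv_fun_add ((hf.1 p.1).contDiffAt.of_le (mod_cast le_top))
    ((hg.1 p.1).contDiffAt.of_le (mod_cast le_top))).symm

theorem bilin (B : V →L[ℝ] W →L[ℝ] Z) (hf : IsCkFamily n f) (hg : IsCkFamily n g) :
    IsCkFamily n fun x θ => B (f x θ) (g x θ) := by
  have continuous_apply : Continuous fun p : X × ℝ => B (f p.1 p.2) (g p.1 p.2) :=
    (B.continuous.comp hf.continuous).clm_apply hg.continuous
  induction n generalizing f g with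
  | zero =>
    exact zero_iff.2 ⟨fun x => (B.contDiff.comp (hf.1 x)).clm_apply (hg.1 x), continuous_apply⟩
  | succ n ih =>
    have leibniz := (ih (hf.of_le n.le_succ) (succ_iff.1 hg).2.2 ?_).add
      (ih (succ_iff.1 hf).2.2 (hg.of_le n.le_succ) ?_)
    · refine of_hasDerivAt continuous_apply (fun x θ => ?_) leibniz
      rw [add_comm]
      exact (B.hasFDerivAt.comp_hasDerivAt θ
        ((hf.1 x).differentiable (by simp) θ).hasDerivAt).clm_apply
          ((hg.1 x).differentiable (by simp) θ).hasDerivAt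
    · exact (B.continuous.comp hf.continuous).clm_apply (succ_iff.1 hg).2.2.continuous
    · exact (B.continuous.comp (succ_iff.1 hf).2.2.continuous).clm_apply hg.continuous

theorem clm_apply {f : X → ℝ → V →L[ℝ] W} {g : X → ℝ → V} (hf : IsCkFamily n f)
    (hg : IsCkFamily n g) : IsCkFamily n fun x θ => f x θ (g x θ) :=
  bilin (ContinuousLinearMap.id ℝ (V →L[ℝ] W)) hf hg

theorem clm_comp {f : X → ℝ → W →L[ℝ] Z} {g : X → ℝ → V →L[ℝ] W} (hf : IsCkFamily n f)
    (hg : IsCkFamily n g) : IsCkFamily n fun x θ => (f x θ).comp (g x θ) :=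
  bilin (ContinuousLinearMap.compL ℝ V W Z) hf hg

theorem clm (L : V →L[ℝ] Z) (hf : IsCkFamily n f) : IsCkFamily n fun x θ => L (f x θ) :=
  clm_apply (const contDiff_const) hf

theorem neg (hf : IsCkFamily n f) : IsCkFamily n fun x θ => -f x θ :=
  hf.clm (-ContinuousLinearMap.id ℝ V)

theorem comp_contDiffOn.{u} {V Z : Type u} [NormedAddCommGroup V] [NormedSpace ℝ V]
    [NormedAddCommGroup Z] [NormedSpace ℝ Z] {s : Set V} (hs : IsOpen s) {m : V → Z}
    (hm : ContDiffOn ℝ ∞ m s) {y : X → ℝ → V} (hy : IsCkFamily n y) (hys : ∀ x θ, y x θ ∈ s) :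
    IsCkFamily n fun x θ => m (y x θ) := by
  have continuous_comp : Continuous fun p : X × ℝ => m (y p.1 p.2) :=
    hm.continuousOn.comp_continuous hy.continuous fun p => hys p.1 p.2
  induction n generalizing Z with
  | zero => exact zero_iff.2 ⟨fun x => hm.comp_contDiff (hy.1 x) (hys x), continuous_comp⟩
  | succ n ih =>
    have hm' : ContDiffOn ℝ ∞ (fderiv ℝ m) s :=
      ((contDiffOn_infty_iff_fderiv_of_isOpen hs).1 hm).2
    have chain := (ih hm' (hy.of_le n.le_succ)
      (hm'.continuousOn.comp_continuous hy.continuous fun p => hys p.1 p.2)).clm_apply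
        (succ_iff.1 hy).2.2
    refine of_hasDerivAt continuous_comp (fun x θ => ?_) chain
    exact ((hm.differentiableOn (by simp)).differentiableAt
      (hs.mem_nhds (hys x θ))).hasFDerivAt.comp_hasDerivAt θ
        ((hy.1 x).differentiable (by simp) θ).hasDerivAt

theorem of_eventually_eq_translate {g : X → ℝ → V} (hf : IsCkFamily n f)
    (h : ∀ θ₀ : ℝ, ∃ c : ℝ, ∀ᶠ θ in 𝓝 θ₀, ∀ x, g x θ = f x (θ - c)) : IsCkFamily n g := by
  have eventuallyEq_translate (θ₀ : ℝ) :
      ∃ c : ℝ, ∀ᶠ θ in 𝓝 θ₀, ∀ x, g x =ᶠ[𝓝 θ] fun τ => f x (τ - c) := by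
    obtain ⟨c, hc⟩ := h θ₀
    exact ⟨c, hc.eventually_nhds.mono fun θ hθ x => hθ.mono fun τ hτ => hτ x⟩
  refine ⟨fun x => contDiff_iff_contDiffAt.2 fun θ => ?_, fun k hk =>
    continuous_iff_continuousAt.2 fun ⟨x, θ⟩ => ?_⟩
  · obtain ⟨c, hc⟩ := eventuallyEq_translate θ
    exact ((hf.1 x).comp (contDiff_id.sub contDiff_const)).contDiffAt.congr_of_eventuallyEq
      (hc.self_of_nhds x)
  · obtain ⟨c, hc⟩ := eventuallyEq_translate θ
    have continuous_translate :
        Continuous fun p : X × ℝ => iteratedDeriv k (f p.1) (p.2 - c) :=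
      (hf.2 k hk).comp (continuous_fst.prodMk (continuous_snd.sub continuous_const))
    refine continuous_translate.continuousAt.congr ?_
    filter_upwards [hc.prod_inr_nhds x] with p hp
    rw [(hp p.1).iteratedDeriv_eq k, iteratedDeriv_comp_sub_const]

end IsCkFamily

theorem periodic_iteratedDeriv {f : ℝ → V} {T : ℝ} (hf : Function.Periodic f T) (k : ℕ) :
    Function.Periodic (iteratedDeriv k f) T := fun θ => by
  have translate := congrFun (iteratedDeriv_comp_add_const k f T) θ
  rw [show (fun z => f (z + T)) = f from funext hf] at translate
  exact translate.symm

theorem continuous_uncurry_of_continuous_uniformFun {M S α : Type*} [PseudoMetricSpace M]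
    [TopologicalSpace S] [TopologicalSpace α] {f : α → S → M} (hf : ∀ x, Continuous (f x))
    (h : Continuous fun x => UniformFun.ofFun (f x)) : Continuous fun p : α × S => f p.1 p.2 := by
  refine continuous_iff_continuousAt.2 fun ⟨x₀, s₀⟩ => Metric.tendsto_nhds.2 fun ε hε => ?_
  have tendstoUniformly : TendstoUniformly f (f x₀) (𝓝 x₀) :=
    UniformFun.tendsto_iff_tendstoUniformly.1 (h.tendsto x₀)
  have uniformly_near := Metric.tendstoUniformly_iff.1 tendstoUniformly (ε / 2) (half_pos hε)
  have near_point := Metric.tendsto_nhds.1 ((hf x₀).tendsto s₀) (ε / 2) (half_pos hε)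
  filter_upwards [uniformly_near.prod_inl_nhds s₀, near_point.prod_inr_nhds x₀] with p hx hs
  calc dist (f p.1 p.2) (f x₀ s₀)
      ≤ dist (f p.1 p.2) (f x₀ p.2) + dist (f x₀ p.2) (f x₀ s₀) := dist_triangle _ _ _
    _ < ε / 2 + ε / 2 := add_lt_add ((dist_comm _ _).trans_lt (hx p.2)) hs
    _ = ε := add_halves ε

theorem continuous_uniformFun_of_periodic {M α : Type*} [PseudoMetricSpace M] [TopologicalSpace α]
    {f : α → ℝ → M} {T : ℝ} (hT : 0 < T) (hp : ∀ x, Function.Periodic (f x) T)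
    (h : Continuous fun p : α × ℝ => f p.1 p.2) : Continuous fun x => UniformFun.ofFun (f x) := by
  refine continuous_iff_continuousAt.2 fun x₀ => UniformFun.tendsto_iff_tendstoUniformly.2 <|
    Metric.tendstoUniformly_iff.2 fun ε hε => ?_
  have continuous_dist : Continuous fun p : α × ℝ => dist (f x₀ p.2) (f p.1 p.2) :=
    (h.comp (continuous_const.prodMk continuous_snd)).dist h
  have near_on_period : ∀ᶠ x in 𝓝 x₀, ∀ θ ∈ Icc 0 T, dist (f x₀ θ) (f x θ) < ε :=
    isCompact_Icc.eventually_forall_of_forall_eventually fun θ _ =>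
      continuous_dist.continuousAt (x := (x₀, θ)).eventually (gt_mem_nhds (by simpa using hε))
  filter_upwards [near_on_period] with x hx θ
  have periodic_dist : Function.Periodic (fun θ => dist (f x₀ θ) (f x θ)) T := fun θ => by
    simp only [hp x₀ θ, hp x θ]
  obtain ⟨θ', hθ', dist_eq⟩ := periodic_dist.exists_mem_Ico₀ hT θ
  exact dist_eq.trans_lt (hx θ' (Ico_subset_Icc_self hθ'))

theorem continuous_smoothCurveTopology_iff {Y : Type*} {a : Y → ℝ → V} {T : ℝ} (hT : 0 < T)
    (ha : ∀ y, ContDiff ℝ ∞ (a y)) (hp : ∀ y, Function.Periodic (a y) T) {F : X → Y} :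
    (@Continuous X Y _ (smoothCurveTopology a) F) ↔ ∀ n, IsCkFamily n fun x => a (F x) := by
  have continuous_induced_iff (k : ℕ) : (@Continuous X Y _ (TopologicalSpace.induced
      (fun x => UniformFun.ofFun (iteratedDeriv k (a x)))
      (inferInstance : TopologicalSpace (UniformFun ℝ V))) F) ↔
      Continuous fun p : X × ℝ => iteratedDeriv k (a (F p.1)) p.2 := by
    rw [continuous_induced_rng]
    exact ⟨continuous_uncurry_of_continuous_uniformFun fun x =>
        (ha (F x)).continuous_iteratedDeriv k (mod_cast le_top),
      continuous_uniformFun_of_periodic hT fun x => periodic_iteratedDeriv (hp (F x)) k⟩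
  rw [continuous_iInf_rng]
  simp only [continuous_induced_iff]
  exact ⟨fun h n => ⟨fun x => ha (F x), fun k _ => h k⟩, fun h k => (h k).2 k le_rfl⟩

end Families

section Periodization

variable {V : Type*} {T a b : ℝ}

/-- The `T`-periodic function which agrees with `f` on `[0, T)`. -/
def periodize (hT : 0 < T) (f : ℝ → V) (θ : ℝ) : V := f (toIcoMod hT 0 θ)

theorem periodic_periodize (hT : 0 < T) (f : ℝ → V) : Function.Periodic (periodize hT f) T :=
  fun θ => by rw [periodize, toIcoMod_add_right, periodize]

theorem periodize_eq_of_support_subset [Zero V] {f : ℝ → V} (hT : 0 < T)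
    (hf : Function.support f ⊆ Icc a b) (ha : 0 ≤ a) (hb : b < T) (m : ℤ) {θ : ℝ}
    (hl : b - T < θ - m * T) (hr : θ - m * T < a + T) : periodize hT f θ = f (θ - m * T) := by
  have eq_zero_of_lt {τ : ℝ} (h : τ < a) : f τ = 0 :=
    Function.notMem_support.1 fun hτ => h.not_ge (hf hτ).1
  have eq_zero_of_gt {τ : ℝ} (h : b < τ) : f τ = 0 :=
    Function.notMem_support.1 fun hτ => h.not_ge (hf hτ).2
  set k := toIcoDiv hT 0 θ
  have toIcoMod_eq : toIcoMod hT 0 θ = θ - k * T := by rw [toIcoMod, zsmul_eq_mul]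
  have hk : θ - k * T ∈ Ico 0 T := by
    simpa only [toIcoMod_eq, zero_add] using toIcoMod_mem_Ico hT 0 θ
  rw [periodize, toIcoMod_eq]
  rcases lt_trichotomy k m with hkm | rfl | hkm
  · have : (k + 1) * T ≤ m * T := mul_le_mul_of_nonneg_right (mod_cast hkm) hT.le
    rw [eq_zero_of_lt (show θ - m * T < a by linarith [hk.2]), eq_zero_of_gt (by linarith)]
  · rfl
  · have : (m + 1) * T ≤ k * T := mul_le_mul_of_nonneg_right (mod_cast hkm) hT.le
    rw [eq_zero_of_gt (show b < θ - m * T by linarith [hk.1]), eq_zero_of_lt (by linarith)]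

theorem IsCkFamily.periodize [NormedAddCommGroup V] [NormedSpace ℝ V] {X : Type*}
    [TopologicalSpace X] {n : ℕ} {f : X → ℝ → V} (hf : IsCkFamily n f) (hT : 0 < T)
    (hs : ∀ x, Function.support (f x) ⊆ Icc a b) (ha : 0 < a) (hb : b < T) :
    IsCkFamily n fun x => periodize hT (f x) := by
  refine hf.of_eventually_eq_translate fun θ₀ => ⟨toIcoDiv hT 0 θ₀ * T, ?_⟩
  have mem_Ico : θ₀ - toIcoDiv hT 0 θ₀ * T ∈ Ico 0 T := by
    simpa only [toIcoMod, zsmul_eq_mul, zero_add] using toIcoMod_mem_Ico hT 0 θ₀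
  have tendsto_translate : ContinuousAt (fun θ => θ - toIcoDiv hT 0 θ₀ * T) θ₀ := by fun_prop
  filter_upwards [
    tendsto_translate.eventually (lt_mem_nhds (show b - T < _ by linarith [mem_Ico.1])),
    tendsto_translate.eventually (gt_mem_nhds (show _ < a + T by linarith [mem_Ico.2]))]
    with θ hl hr x
  exact periodize_eq_of_support_subset hT (hs x) ha.le hb _ hl hr

end Periodization

/-- A smooth step function from `0` to `1` on the interval `[1, 2]`. -/
def smoothStep (θ : ℝ) : ℝ := Real.smoothTransition (θ - 1)

theorem contDiff_smoothStep : ContDiff ℝ ∞ smoothStep :=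
  Real.smoothTransition.contDiff.comp (contDiff_id.sub contDiff_const)

theorem smoothStep_of_le_one {θ : ℝ} (h : θ ≤ 1) : smoothStep θ = 0 :=
  Real.smoothTransition.zero_of_nonpos (sub_nonpos.2 h)

theorem smoothStep_of_two_le {θ : ℝ} (h : 2 ≤ θ) : smoothStep θ = 1 :=
  Real.smoothTransition.one_of_one_le (by linarith)

theorem smoothStep_mem_Icc (θ : ℝ) : smoothStep θ ∈ Icc 0 1 :=
  ⟨Real.smoothTransition.nonneg _, Real.smoothTransition.le_one _⟩

theorem support_deriv_smoothStep_subset : Function.support (deriv smoothStep) ⊆ Icc 1 2 := by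
  refine fun θ hθ => ⟨?_, ?_⟩ <;> by_contra! h <;> refine hθ ?_
  · have : smoothStep =ᶠ[𝓝 θ] fun _ => 0 :=
      (gt_mem_nhds h).mono fun τ hτ => smoothStep_of_le_one (le_of_lt hτ)
    rw [this.deriv_eq, deriv_const]
  · have : smoothStep =ᶠ[𝓝 θ] fun _ => 1 :=
      (lt_mem_nhds h).mono fun τ hτ => smoothStep_of_two_le (le_of_lt hτ)
    rw [this.deriv_eq, deriv_const]

/-! ### The topologies on connections and loops -/

section Topologies

variable {E : Type*} [NormedAddCommGroup E] [NormedSpace ℝ E]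
  {H : Type*} [TopologicalSpace H] {I : ModelWithCorners ℝ E H}
  {G : Type*} [TopologicalSpace G] [ChartedSpace H G] [Group G] [LieGroup I ∞ G]
  {X : Type*} [TopologicalSpace X]

theorem CircleConnection.continuous_iff {F : X → CircleConnection I G} :
    Continuous F ↔ ∀ n, IsCkFamily n fun x => (F x).coeff :=
  continuous_smoothCurveTopology_iff Real.two_pi_pos (fun A => A.contDiff_coeff)
    fun A => A.coeff_periodic

theorem CircleConnection.isCkFamily_coeff (n : ℕ) :
    IsCkFamily n fun A : CircleConnection I G => A.coeff :=
  CircleConnection.continuous_iff.1 continuous_id n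

variable [I.Boundaryless]

section Adjoint

variable {n : ℕ} {h : X → ℝ → G} {c : X → ℝ → E}

theorem IsCkFamily.adjointCLM (hh : Continuous fun p : X × ℝ => h p.1 p.2)
    (hs : ∀ x, ContMDiff 𝓘(ℝ, ℝ) I ∞ (h x)) (hl : ∀ x θ, HasLeftLogDerivAt I (h x) (c x θ) θ)
    (hc : IsCkFamily n c) : IsCkFamily (n + 1) fun x θ => adjointCLM I (h x θ) := by
  have isC0Family : IsCkFamily 0 fun x θ => _root_.adjointCLM I (h x θ) :=
    zero_iff.2 ⟨fun x => (contMDiff_adjointCLM.comp (hs x)).contDiff,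
      contMDiff_adjointCLM.continuous.comp hh⟩
  induction n with
  | zero =>
    exact of_hasDerivAt isC0Family.continuous (fun x θ => (hl x θ).hasDerivAt_adjointCLM)
      (isC0Family.clm_comp (hc.clm _))
  | succ n ih =>
    exact of_hasDerivAt isC0Family.continuous (fun x θ => (hl x θ).hasDerivAt_adjointCLM)
      ((ih (hc.of_le n.le_succ)).clm_comp (hc.clm _))

theorem IsCkFamily.adjointCLM_inv (hh : Continuous fun p : X × ℝ => h p.1 p.2)
    (hs : ∀ x, ContMDiff 𝓘(ℝ, ℝ) I ∞ (h x)) (hl : ∀ x θ, HasLeftLogDerivAt I (h x) (c x θ) θ)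
    (hc : IsCkFamily n c) : IsCkFamily (n + 1) fun x θ => _root_.adjointCLM I (h x θ)⁻¹ := by
  have := topologicalGroup_of_lieGroup I ∞ (G := G)
  exact IsCkFamily.adjointCLM hh.inv (fun x => (hs x).inv) (fun x θ => (hl x θ).inv)
    (((IsCkFamily.adjointCLM hh hs hl hc).of_le n.le_succ).clm_apply hc).neg

end Adjoint

namespace SmoothLoop

theorem continuous_iff {F : X → SmoothLoop I G} :
    Continuous F ↔ (Continuous fun p : X × Circle => F p.1 p.2) ∧
      ∀ n, IsCkFamily n fun x => (F x).logDeriv := by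
  refine (@continuous_inf_rng X (SmoothLoop I G) F inferInstance
    (TopologicalSpace.induced (fun g => (g : C(Circle, G))) ContinuousMap.compactOpen)
    (smoothCurveTopology logDeriv)).trans (and_congr ?_ ?_)
  · rw [continuous_induced_rng]
    exact ⟨fun h => continuous_eval.comp ((h.comp continuous_fst).prodMk continuous_snd),
      fun h => ContinuousMap.continuous_of_continuous_uncurry _ h⟩
  · exact continuous_smoothCurveTopology_iff Real.two_pi_pos (fun g => g.contDiff_logDeriv)
      fun g => g.logDeriv_periodic

theorem isCkFamily_logDeriv (n : ℕ) : IsCkFamily n fun g : SmoothLoop I G => g.logDeriv :=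
  (continuous_iff.1 continuous_id).2 n

theorem continuous_uncurry : Continuous fun p : SmoothLoop I G × Circle => p.1 p.2 :=
  (continuous_iff.1 continuous_id).1

theorem continuous_uncurry_circleExp :
    Continuous fun p : SmoothLoop I G × ℝ => p.1 (Circle.exp p.2) :=
  continuous_uncurry.comp (continuous_fst.prodMk (Circle.exp.continuous.comp continuous_snd))

theorem isCkFamily_adjointCLM (n : ℕ) :
    IsCkFamily n fun (g : SmoothLoop I G) θ => adjointCLM I (g (Circle.exp θ)) :=
  (IsCkFamily.adjointCLM continuous_uncurry_circleExp contMDiff_comp_circleExp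
    hasLeftLogDerivAt (isCkFamily_logDeriv n)).of_le n.le_succ

theorem isCkFamily_adjointCLM_inv (n : ℕ) :
    IsCkFamily n fun (g : SmoothLoop I G) θ => adjointCLM I (g (Circle.exp θ))⁻¹ :=
  (IsCkFamily.adjointCLM_inv continuous_uncurry_circleExp contMDiff_comp_circleExp
    hasLeftLogDerivAt (isCkFamily_logDeriv n)).of_le n.le_succ

theorem logDeriv_mul (g h : SmoothLoop I G) (θ : ℝ) :
    (g * h).logDeriv θ = adjointCLM I (h (Circle.exp θ))⁻¹ (g.logDeriv θ) + h.logDeriv θ :=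
  ((g * h).hasLeftLogDerivAt θ).unique ((g.hasLeftLogDerivAt θ).mul (h.hasLeftLogDerivAt θ))

theorem logDeriv_inv (g : SmoothLoop I G) (θ : ℝ) :
    g⁻¹.logDeriv θ = -adjointCLM I (g (Circle.exp θ)) (g.logDeriv θ) :=
  (g⁻¹.hasLeftLogDerivAt θ).unique (g.hasLeftLogDerivAt θ).inv

variable (I G) in
theorem isTopologicalGroup : IsTopologicalGroup (SmoothLoop I G) where
  continuous_mul := by
    have := topologicalGroup_of_lieGroup I ∞ (G := G)
    refine continuous_iff.2 ⟨?_, fun n => ?_⟩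
    · exact (continuous_uncurry.comp ((continuous_fst.comp continuous_fst).prodMk
        continuous_snd)).mul (continuous_uncurry.comp
          ((continuous_snd.comp continuous_fst).prodMk continuous_snd))
    · simp only [funext (logDeriv_mul _ _)]
      exact (((isCkFamily_adjointCLM_inv n).comp continuous_snd).clm_apply
        ((isCkFamily_logDeriv n).comp continuous_fst)).add
          ((isCkFamily_logDeriv n).comp continuous_snd)
  continuous_inv := by
    have := topologicalGroup_of_lieGroup I ∞ (G := G)
    refine continuous_iff.2 ⟨continuous_uncurry.inv, fun n => ?_⟩
    simp only [funext (logDeriv_inv _)]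
    exact ((isCkFamily_adjointCLM n).clm_apply (isCkFamily_logDeriv n)).neg

end SmoothLoop

variable (I G) in
theorem CircleConnection.continuous_pullback :
    Continuous fun p : CircleConnection I G × SmoothLoop I G => p.1.pullback p.2 := by
  refine CircleConnection.continuous_iff.2 fun n => ?_
  simp only [funext (coeff_pullback _ _)]
  exact (((SmoothLoop.isCkFamily_adjointCLM_inv n).comp continuous_snd).clm_apply
    ((isCkFamily_coeff n).comp continuous_fst)).add
      ((SmoothLoop.isCkFamily_logDeriv n).comp continuous_snd)

end Topologies

/-! ### Morita morphisms -/

theorem isOpenMap_pullback_snd {X Y Z : Type*} [TopologicalSpace X] [TopologicalSpace Y]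
    [TopologicalSpace Z] {f : X → Z} {g : Y → Z} (hf : IsOpenMap f) (hg : Continuous g) :
    IsOpenMap fun q : {q : X × Y // f q.1 = g q.2} => q.1.2 := by
  refine isOpenMap_iff_nhds_le.2 fun q U hU => ?_
  obtain ⟨W, hW, hWU⟩ := mem_nhds_induced _ _ _ |>.1 hU
  obtain ⟨A, hA, B, hB, hAB⟩ := mem_nhds_prod_iff.1 hW
  have image_mem : f '' A ∈ 𝓝 (g q.1.2) := q.2 ▸ hf.image_mem_nhds hA
  filter_upwards [hB, hg.continuousAt image_mem] with y hy ⟨x, hx, hxy⟩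
  exact hWU (a := ⟨(x, y), hxy⟩) (hAB ⟨hx, hy⟩)

namespace SpaceGroupoid

universe u₀ u₁ v₀ v₁

theorem Hom.isMorita_of_isOpenMap {K : SpaceGroupoid.{u₀, u₁}} {L : SpaceGroupoid.{v₀, v₁}}
    {Ψ : Hom K L} (ht : Continuous L.t) (hs : IsOpenMap L.s) (hopen : IsOpenMap Ψ.obj)
    (hsurj : Function.Surjective Ψ.obj) (hcart : IsHomeomorph Ψ.toArrowPullback) :
    Ψ.IsMorita where
  cartesian := hcart
  isOpenMap := hs.comp (isOpenMap_pullback_snd hopen ht)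
  surjective y := by
    obtain ⟨x, rfl⟩ := hsurj y
    exact ⟨⟨(x, L.e (Ψ.obj x)), (L.t_e _).symm⟩, L.s_e _⟩

/-- The identity morphism of a groupoid. -/
protected def Hom.id (K : SpaceGroupoid.{u₀, u₁}) : Hom K K where
  obj := _root_.id
  arr := _root_.id
  continuous_obj := continuous_id
  continuous_arr := continuous_id
  map_s _ := rfl
  map_t _ := rfl
  map_e _ := rfl
  map_i _ := rfl
  map_m _ := rfl

theorem IsTopological.isMorita_id {K : SpaceGroupoid.{u₀, u₁}} (hK : K.IsTopological)
    (hs : IsOpenMap K.s) : (Hom.id K).IsMorita := by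
  refine Hom.isMorita_of_isOpenMap hK.continuous_t hs IsOpenMap.id Function.surjective_id ?_
  refine isHomeomorph_iff_exists_inverse.2 ⟨?_, fun q => q.1.2, fun _ => rfl, fun q => ?_,
    continuous_snd.comp continuous_subtype_val⟩
  · exact ((hK.continuous_s.prodMk hK.continuous_t).prodMk continuous_id).subtype_mk _
  · exact Subtype.ext (Prod.ext q.2.symm rfl)

end SpaceGroupoid

theorem isTopological_rightActionGroupoid {X Γ : Type*} [TopologicalSpace X] [TopologicalSpace Γ]
    [Group Γ] [IsTopologicalGroup Γ] {act : X → Γ → X} (act_one : ∀ x, act x 1 = x)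
    (act_mul : ∀ x g h, act x (g * h) = act (act x g) h)
    (hact : Continuous fun p : X × Γ => act p.1 p.2) :
    (rightActionGroupoid act act_one act_mul).IsTopological where
  continuous_s := continuous_fst
  continuous_t := hact
  continuous_e := continuous_id.prodMk continuous_const
  continuous_i := hact.prodMk continuous_snd.inv
  continuous_m := by
    have continuous_mul : Continuous fun p : {p : (X × Γ) × (X × Γ) // act p.1.1 p.1.2 = p.2.1} =>
        (p.1.1.1, p.1.1.2 * p.1.2.2) := by fun_prop
    exact continuous_mul

theorem isOpenMap_s_rightActionGroupoid {X Γ : Type*} [TopologicalSpace X] [TopologicalSpace Γ]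
    [Group Γ] {act : X → Γ → X} (act_one : ∀ x, act x 1 = x)
    (act_mul : ∀ x g h, act x (g * h) = act (act x g) h) :
    IsOpenMap (rightActionGroupoid act act_one act_mul).s :=
  isOpenMap_fst

/-! ### Parallel transport and holonomy -/

theorem continuous_uncurry_circleExp_iff {X Y : Type*} [TopologicalSpace X] [TopologicalSpace Y]
    {f : X × Circle → Y} :
    (Continuous fun p : X × ℝ => f (p.1, Circle.exp p.2)) ↔ Continuous f := by
  have isOpenQuotientMap_exp : IsOpenQuotientMap (Circle.exp : ℝ → Circle) :=
    ⟨fun z => ⟨_, Circle.exp_arg z⟩, Circle.exp.continuous, isLocalHomeomorph_circleExp.isOpenMap⟩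
  exact (IsOpenQuotientMap.id.prodMap isOpenQuotientMap_exp).isQuotientMap.continuous_iff.symm

section Holonomy

variable {E : Type*} [NormedAddCommGroup E] [NormedSpace ℝ E] [CompleteSpace E]
  {H : Type*} [TopologicalSpace H] {I : ModelWithCorners ℝ E H} [I.Boundaryless]
  {G : Type*} [TopologicalSpace G] [ChartedSpace H G] [Group G] [LieGroup I ∞ G]

namespace CircleConnection

theorem exists_transport (A : CircleConnection I G) :
    ∃ γ : ℝ → G, γ 0 = 1 ∧ ∀ θ, HasLeftLogDerivAt I γ (A.coeff θ) θ :=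
  exists_hasLeftLogDerivAt (A.contDiff_coeff.of_le (mod_cast le_top))

/-- The inverse of parallel transport along the circle: if `(exp(iθ), u θ)` is the horizontal lift
which starts at `(1, 1)`, then `A.transport θ = (u θ)⁻¹`. The inverse has left logarithmic
derivative `A.coeff`, whereas that of `u` also involves the adjoint action of `u`. -/
def transport (A : CircleConnection I G) : ℝ → G :=
  A.exists_transport.choose

theorem transport_zero (A : CircleConnection I G) : A.transport 0 = 1 :=
  A.exists_transport.choose_spec.1

theorem hasLeftLogDerivAt_transport (A : CircleConnection I G) (θ : ℝ) :
    HasLeftLogDerivAt I A.transport (A.coeff θ) θ :=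
  A.exists_transport.choose_spec.2 θ

theorem eq_transport {A : CircleConnection I G} {γ : ℝ → G} (h0 : γ 0 = 1)
    (h : ∀ θ, HasLeftLogDerivAt I γ (A.coeff θ) θ) : γ = A.transport :=
  eq_of_hasLeftLogDerivAt h A.hasLeftLogDerivAt_transport (h0.trans A.transport_zero.symm)

theorem contMDiff_transport (A : CircleConnection I G) : ContMDiff 𝓘(ℝ, ℝ) I ∞ A.transport :=
  contMDiff_of_hasLeftLogDerivAt A.contDiff_coeff A.hasLeftLogDerivAt_transport

theorem continuous_transport :
    Continuous fun p : CircleConnection I G × ℝ => p.1.transport p.2 :=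
  continuous_uncurry_of_hasLeftLogDerivAt (isCkFamily_coeff 0).continuous transport_zero
    hasLeftLogDerivAt_transport

theorem transport_add_two_pi (A : CircleConnection I G) (θ : ℝ) :
    A.transport (θ + 2 * Real.pi) = A.transport (2 * Real.pi) * A.transport θ := by
  have h : (fun τ => (A.transport (2 * Real.pi))⁻¹ * A.transport (τ + 2 * Real.pi)) =
      A.transport := by
    refine eq_transport (by simp) fun τ => HasLeftLogDerivAt.const_mul ?_ _
    have := (A.hasLeftLogDerivAt_transport (τ + 2 * Real.pi)).comp_hasDerivAt
      (f := fun τ => τ + 2 * Real.pi) ((hasDerivAt_id τ).add_const _)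
    rwa [one_smul, A.coeff_periodic] at this
  rw [← congrFun h θ, mul_inv_cancel_left]

theorem transport_pullback (A : CircleConnection I G) (g : SmoothLoop I G) (θ : ℝ) :
    (A.pullback g).transport θ = (g 1)⁻¹ * (A.transport θ * g (Circle.exp θ)) := by
  have h : (fun τ => (g 1)⁻¹ * (A.transport τ * g (Circle.exp τ))) =
      (A.pullback g).transport := by
    refine eq_transport (by simp [transport_zero]) fun τ => HasLeftLogDerivAt.const_mul ?_ _
    rw [coeff_pullback]
    exact (A.hasLeftLogDerivAt_transport τ).mul (g.hasLeftLogDerivAt τ)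
  exact (congrFun h θ).symm

theorem inv_eq_transport_of_horizontal {A : CircleConnection I G} {u : ℝ → G}
    (hu : MDifferentiable 𝓘(ℝ, ℝ) I u) (h0 : u 0 = 1)
    (hA : ∀ θ : ℝ, A.form (Circle.exp θ, u θ) (mfderiv 𝓘(ℝ, ℝ) ((𝓡 1).prod I)
      (fun τ : ℝ => (Circle.exp τ, u τ)) θ (1 : ℝ)) = 0) :
    (fun θ => (u θ)⁻¹) = A.transport := by
  refine eq_transport (by simp [h0]) fun θ => ?_
  obtain ⟨ξ, hξ⟩ : ∃ ξ : E, HasLeftLogDerivAt I u ξ θ := ⟨_, hasLeftLogDerivAt_mfderiv (hu θ)⟩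
  have horizontal : adjointCLM I (u θ)⁻¹ (A.coeff θ) + ξ = 0 :=
    (A.form_mfderiv_circleExp_prodMk (hu θ) hξ).symm.trans (hA θ)
  have hasLeftLogDerivAt_inv := hξ.inv
  rwa [eq_neg_of_add_eq_zero_right horizontal, map_neg, neg_neg, adjointCLM_apply_inv_apply]
    at hasLeftLogDerivAt_inv

theorem form_inv_transport (A : CircleConnection I G) (θ : ℝ) :
    A.form (Circle.exp θ, (A.transport θ)⁻¹) (mfderiv 𝓘(ℝ, ℝ) ((𝓡 1).prod I)
      (fun τ : ℝ => (Circle.exp τ, (A.transport τ)⁻¹)) θ (1 : ℝ)) = 0 := by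
  have h := A.form_mfderiv_circleExp_prodMk (A.contMDiff_transport.inv.mdifferentiableAt (by simp))
    (A.hasLeftLogDerivAt_transport θ).inv
  rw [inv_inv, add_neg_cancel] at h
  exact h

/-- The holonomy of a connection around the circle. -/
def hol (A : CircleConnection I G) : G := (A.transport (2 * Real.pi))⁻¹

theorem hasHolonomy_iff (A : CircleConnection I G) (x : G) : A.HasHolonomy x ↔ x = A.hol := by
  constructor
  · rintro ⟨u, hu, h0, rfl, hA⟩
    exact inv_eq_iff_eq_inv.1 <| congrFun
      (inv_eq_transport_of_horizontal (hu.mdifferentiable (by simp)) h0 hA) (2 * Real.pi)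
  · rintro rfl
    exact ⟨fun θ => (A.transport θ)⁻¹, A.contMDiff_transport.inv, by simp [transport_zero], rfl,
      A.form_inv_transport⟩

theorem transport_two_pi (A : CircleConnection I G) : A.transport (2 * Real.pi) = A.hol⁻¹ :=
  (inv_inv _).symm

theorem hol_pullback (A : CircleConnection I G) (g : SmoothLoop I G) :
    (A.pullback g).hol = (g 1)⁻¹ * A.hol * g 1 := by
  rw [hol, transport_pullback, Circle.exp_two_pi, transport_two_pi]
  group

theorem continuous_hol : Continuous fun A : CircleConnection I G => A.hol := by
  have := topologicalGroup_of_lieGroup I ∞ (G := G)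
  exact (continuous_transport.comp (continuous_id.prodMk continuous_const)).inv

/-- The loop `g` with `g 1 = h` and `A.pullback g = B`, where `B.hol` is the conjugate of `A.hol`
by `h⁻¹`. -/
def gaugeLoop (A B : CircleConnection I G) (h : G) (hAB : B.hol = h⁻¹ * A.hol * h) :
    SmoothLoop I G :=
  loopOfPeriodic (fun θ => (A.transport θ)⁻¹ * h * B.transport θ)
    ((A.contMDiff_transport.inv.mul contMDiff_const).mul B.contMDiff_transport) (by
      intro θ
      simp only [transport_add_two_pi, transport_two_pi, hAB]
      group)

section GaugeLoop

variable {A B : CircleConnection I G} {h : G}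

theorem gaugeLoop_circleExp (hAB : B.hol = h⁻¹ * A.hol * h) (θ : ℝ) :
    gaugeLoop A B h hAB (Circle.exp θ) = (A.transport θ)⁻¹ * h * B.transport θ :=
  loopOfPeriodic_circleExp _ _ θ

theorem gaugeLoop_one (hAB : B.hol = h⁻¹ * A.hol * h) : gaugeLoop A B h hAB 1 = h := by
  simpa [transport_zero] using gaugeLoop_circleExp hAB 0

theorem logDeriv_gaugeLoop (hAB : B.hol = h⁻¹ * A.hol * h) (θ : ℝ) :
    (gaugeLoop A B h hAB).logDeriv θ =
      -adjointCLM I (gaugeLoop A B h hAB (Circle.exp θ))⁻¹ (A.coeff θ) + B.coeff θ := by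
  have hasLeftLogDerivAt_gaugeLoop := (gaugeLoop A B h hAB).hasLeftLogDerivAt θ
  simp only [gaugeLoop_circleExp] at hasLeftLogDerivAt_gaugeLoop
  rw [hasLeftLogDerivAt_gaugeLoop.unique (((A.hasLeftLogDerivAt_transport θ).inv.mul_const h).mul
    (B.hasLeftLogDerivAt_transport θ)), gaugeLoop_circleExp, map_neg, map_neg]
  simp only [mul_inv_rev, inv_inv, adjointCLM_mul, ContinuousLinearMap.comp_apply]

theorem pullback_gaugeLoop (hAB : B.hol = h⁻¹ * A.hol * h) :
    A.pullback (gaugeLoop A B h hAB) = B :=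
  ext_coeff fun θ => by rw [coeff_pullback, logDeriv_gaugeLoop, add_neg_cancel_left]

theorem gaugeLoop_pullback (A : CircleConnection I G) (g : SmoothLoop I G) :
    gaugeLoop A (A.pullback g) (g 1) (A.hol_pullback g) = g := by
  refine ContMDiffMap.ext fun z => ?_
  obtain ⟨θ, rfl⟩ : ∃ θ, Circle.exp θ = z := ⟨_, Circle.exp_arg z⟩
  rw [gaugeLoop_circleExp, transport_pullback]
  group

end GaugeLoop

section Continuity

variable {X : Type*} [TopologicalSpace X] {A B : X → CircleConnection I G} {h : X → G}

theorem continuous_gaugeLoop_circleExp (hA : Continuous A) (hB : Continuous B) (hh : Continuous h)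
    (hAB : ∀ x, (B x).hol = (h x)⁻¹ * (A x).hol * h x) :
    Continuous fun p : X × ℝ =>
      gaugeLoop (A p.1) (B p.1) (h p.1) (hAB p.1) (Circle.exp p.2) := by
  have := topologicalGroup_of_lieGroup I ∞ (G := G)
  simp only [gaugeLoop_circleExp]
  exact ((continuous_transport.comp ((hA.comp continuous_fst).prodMk continuous_snd)).inv.mul
    (hh.comp continuous_fst)).mul
      (continuous_transport.comp ((hB.comp continuous_fst).prodMk continuous_snd))

-- The logarithmic derivative of the gauge loop is an expression in the loop itself, which gains
-- one order of differentiability at each step.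
theorem isCkFamily_logDeriv_gaugeLoop (hA : Continuous A) (hB : Continuous B) (hh : Continuous h)
    (hAB : ∀ x, (B x).hol = (h x)⁻¹ * (A x).hol * h x) (n : ℕ) :
    IsCkFamily n fun x => (gaugeLoop (A x) (B x) (h x) (hAB x)).logDeriv := by
  have hg := continuous_gaugeLoop_circleExp hA hB hh hAB
  have hsmooth (x : X) := contMDiff_comp_circleExp (gaugeLoop (A x) (B x) (h x) (hAB x))
  have isCkFamily_of_adjointCLM {n : ℕ} (hn : IsCkFamily n fun x θ =>
      adjointCLM I (gaugeLoop (A x) (B x) (h x) (hAB x) (Circle.exp θ))⁻¹) :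
      IsCkFamily n fun x => (gaugeLoop (A x) (B x) (h x) (hAB x)).logDeriv := by
    simp only [funext (logDeriv_gaugeLoop _)]
    exact (hn.clm_apply (continuous_iff.1 hA n)).neg.add (continuous_iff.1 hB n)
  induction n with
  | zero =>
    have := topologicalGroup_of_lieGroup I ∞ (G := G)
    exact isCkFamily_of_adjointCLM <| IsCkFamily.zero_iff.2
      ⟨fun x => (contMDiff_adjointCLM.comp (hsmooth x).inv).contDiff,
        contMDiff_adjointCLM.continuous.comp hg.inv⟩
  | succ n ih =>
    exact isCkFamily_of_adjointCLM <|
      IsCkFamily.adjointCLM_inv hg hsmooth (fun x => SmoothLoop.hasLeftLogDerivAt _) ih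

theorem continuous_gaugeLoop (hA : Continuous A) (hB : Continuous B) (hh : Continuous h)
    (hAB : ∀ x, (B x).hol = (h x)⁻¹ * (A x).hol * h x) :
    Continuous fun x => gaugeLoop (A x) (B x) (h x) (hAB x) :=
  SmoothLoop.continuous_iff.2
    ⟨continuous_uncurry_circleExp_iff.1 (continuous_gaugeLoop_circleExp hA hB hh hAB),
      isCkFamily_logDeriv_gaugeLoop hA hB hh hAB⟩

end Continuity

end CircleConnection

variable (I G) in
/-- The morphism from the groupoid of connections to the conjugation groupoid which is given by the
holonomy on objects and by evaluation of loops at `1` on arrows. -/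
def holonomyHom : SpaceGroupoid.Hom (connectionGroupoid I G) (conjugationGroupoid G) where
  obj := CircleConnection.hol (I := I) (G := G)
  arr a := ((CircleConnection.hol (I := I) a.1 : G), (a.2 : SmoothLoop I G) 1)
  continuous_obj := CircleConnection.continuous_hol (I := I) (G := G)
  continuous_arr := (CircleConnection.continuous_hol.comp continuous_fst).prodMk
    ((SmoothLoop.continuous_uncurry (I := I) (G := G)).comp
      (continuous_snd.prodMk continuous_const))
  map_s _ := rfl
  map_t a := (CircleConnection.hol_pullback a.1 a.2).symm
  map_e _ := rfl
  map_i a := Prod.ext (CircleConnection.hol_pullback a.1 a.2) rfl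
  map_m _ := rfl

variable (I G) in
theorem isHomeomorph_holonomyHom_toArrowPullback :
    IsHomeomorph (holonomyHom I G).toArrowPullback := by
  have hol_eq (q : (holonomyHom I G).ArrowPullback) :
      CircleConnection.hol q.1.1.2 = (q.1.2.2)⁻¹ * CircleConnection.hol q.1.1.1 * q.1.2.2 :=
    (congrArg Prod.snd q.2).trans
      (congrArg (fun x : G => (q.1.2.2 : G)⁻¹ * x * q.1.2.2) (congrArg Prod.fst q.2).symm)
  refine isHomeomorph_iff_exists_inverse.2 ⟨?_,
    fun q => (q.1.1.1, CircleConnection.gaugeLoop q.1.1.1 q.1.1.2 q.1.2.2 (hol_eq q)),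
    fun a => Prod.ext rfl (CircleConnection.gaugeLoop_pullback a.1 a.2),
    fun q => Subtype.ext (Prod.ext
      (Prod.ext rfl (CircleConnection.pullback_gaugeLoop (hol_eq q)))
      (Prod.ext (Prod.ext_iff.1 q.2).1 (CircleConnection.gaugeLoop_one (hol_eq q)))), ?_⟩
  · exact ((continuous_fst.prodMk (CircleConnection.continuous_pullback I G)).prodMk
      (holonomyHom I G).continuous_arr).subtype_mk _
  · have hval : Continuous fun q : (holonomyHom I G).ArrowPullback => q.1 :=
      continuous_subtype_val
    have hA := continuous_fst.comp (continuous_fst.comp hval)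
    exact hA.prodMk (CircleConnection.continuous_gaugeLoop hA
      (continuous_snd.comp (continuous_fst.comp hval))
      (continuous_snd.comp (continuous_snd.comp hval)) hol_eq)

end Holonomy

/-! ### Deformation of connections -/

section Deformation

variable {E : Type*} [NormedAddCommGroup E] [NormedSpace ℝ E]
  {H : Type*} [TopologicalSpace H] (I : ModelWithCorners ℝ E H)
  (G : Type*) [TopologicalSpace G] [ChartedSpace H G] [Group G]

/-- The smooth curve along the segment from `unitCoord I G` to `y`, constant outside of `[1, 2]`. -/
def coordPath (y : E) (θ : ℝ) : E := unitCoord I G + smoothStep θ • (y - unitCoord I G)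

/-- The left logarithmic derivative of the curve in `G` with coordinates `coordPath I G y`. -/
def coordPathLogDeriv (y : E) (θ : ℝ) : E :=
  maurerCartanChart I G (coordPath I G y θ) (deriv smoothStep θ • (y - unitCoord I G))

theorem coordPath_zero (y : E) : coordPath I G y 0 = unitCoord I G := by
  simp [coordPath, smoothStep_of_le_one]

theorem coordPath_two_pi (y : E) : coordPath I G y (2 * Real.pi) = y := by
  simp [coordPath, smoothStep_of_two_le (by linarith [Real.pi_gt_three] : 2 ≤ 2 * Real.pi)]

theorem coordPathLogDeriv_unitCoord (θ : ℝ) : coordPathLogDeriv I G (unitCoord I G) θ = 0 := by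
  simp [coordPathLogDeriv]

theorem support_coordPathLogDeriv_subset (y : E) :
    Function.support (coordPathLogDeriv I G y) ⊆ Icc 1 2 :=
  fun θ hθ => support_deriv_smoothStep_subset fun h =>
    hθ (by rw [coordPathLogDeriv, h, zero_smul, map_zero])

variable {I G} in
theorem hasLeftLogDerivAt_coordPath [LieGroup I ∞ G] [I.Boundaryless] {y : E} {θ : ℝ}
    (hy : coordPath I G y θ ∈ (unitChart I G).target) :
    HasLeftLogDerivAt I (fun θ => (unitChart I G).symm (coordPath I G y θ))
      (coordPathLogDeriv I G y θ) θ :=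
  hasLeftLogDerivAt_unitChart_symm_comp
    (((contDiff_smoothStep.differentiable (by simp) θ).hasDerivAt.smul_const _).const_add _) hy

variable {I G} in
theorem isCkFamily_coordPathLogDeriv [LieGroup I ∞ G] [I.Boundaryless] {U : Set E}
    (hU : ∀ (y : U) (θ : ℝ), coordPath I G y θ ∈ (unitChart I G).target) (n : ℕ) :
    IsCkFamily n fun y : U => coordPathLogDeriv I G y := by
  have isCkFamily_smul {φ : ℝ → ℝ} (hφ : ContDiff ℝ ∞ φ) :
      IsCkFamily n fun (y : U) θ => φ θ • ((y : E) - unitCoord I G) :=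
    IsCkFamily.bilin (ContinuousLinearMap.lsmul ℝ ℝ) (IsCkFamily.const hφ)
      (IsCkFamily.of_continuous (continuous_subtype_val.sub continuous_const))
  have isCkFamily_coordPath : IsCkFamily n fun y : U => coordPath I G y :=
    (IsCkFamily.const contDiff_const).add (isCkFamily_smul contDiff_smoothStep)
  exact (IsCkFamily.comp_contDiffOn (isOpen_unitChart_target I G)
    (fun z hz => (contDiffAt_maurerCartanChart hz).contDiffWithinAt) isCkFamily_coordPath
      hU).clm_apply (isCkFamily_smul (contDiff_infty_iff_deriv.1 contDiff_smoothStep).2)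

end Deformation

namespace CircleConnection

variable {E : Type*} [NormedAddCommGroup E] [NormedSpace ℝ E] [CompleteSpace E]
  {H : Type*} [TopologicalSpace H] {I : ModelWithCorners ℝ E H} [I.Boundaryless]
  {G : Type*} [TopologicalSpace G] [ChartedSpace H G] [Group G] [LieGroup I ∞ G]

theorem hol_eq_of_coeff_eq {A B : CircleConnection I G} {κ : ℝ → G} {c : ℝ → E} {S : Set ℝ}
    (hS : IsOpen S) (hSc : IsPreconnected S) (hS0 : 0 ∈ S) (hS1 : 2 * Real.pi ∈ S)
    (hκ : ∀ θ ∈ S, HasLeftLogDerivAt I κ (c θ) θ) (hκ0 : κ 0 = 1)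
    (hB : ∀ θ ∈ S, B.coeff θ = A.coeff θ + adjointCLM I (A.transport θ)⁻¹ (c θ)) :
    B.hol = A.hol * (κ (2 * Real.pi))⁻¹ := by
  have transport_eq : EqOn B.transport (fun θ => κ θ * A.transport θ) S := by
    refine eqOn_of_hasLeftLogDerivAt hS hSc (fun θ _ => B.hasLeftLogDerivAt_transport θ)
      (fun θ hθ => ?_) hS0 (by simp [transport_zero, hκ0])
    rw [hB θ hθ, add_comm]
    exact (hκ θ hθ).mul (A.hasLeftLogDerivAt_transport θ)
  rw [hol, transport_eq hS1, mul_inv_rev, hol]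

theorem exists_deformation (A : CircleConnection I G) {U : Set E} (hUc : Convex ℝ U)
    (hU1 : unitCoord I G ∈ U) (hU : U ⊆ (unitChart I G).target) :
    ∃ F : U → CircleConnection I G, Continuous F ∧ F ⟨unitCoord I G, hU1⟩ = A ∧
      ∀ y : U, (F y).hol = A.hol * ((unitChart I G).symm y)⁻¹ := by
  have coordPath_mem (y : U) (θ : ℝ) : coordPath I G y θ ∈ (unitChart I G).target :=
    hU (hUc.add_smul_sub_mem hU1 y.2 (smoothStep_mem_Icc θ))
  let bump (y : U) (θ : ℝ) : E := adjointCLM I (A.transport θ)⁻¹ (coordPathLogDeriv I G y θ)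
  have support_bump (y : U) : Function.support (bump y) ⊆ Icc 1 2 :=
    fun θ hθ => support_coordPathLogDeriv_subset I G y fun h =>
      hθ (by simp only [bump, h, map_zero])
  have three_lt : 3 < Real.pi := Real.pi_gt_three
  have two_lt : 2 < 2 * Real.pi := by linarith
  have isCkFamily_periodize (n : ℕ) : IsCkFamily n fun y => periodize Real.two_pi_pos (bump y) :=
    ((IsCkFamily.const (contMDiff_adjointCLM.comp A.contMDiff_transport.inv).contDiff).clm_apply
      (isCkFamily_coordPathLogDeriv coordPath_mem n)).periodize _ support_bump one_pos two_lt
  have exists_coeff (y : U) : ∃ B : CircleConnection I G,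
      B.coeff = fun θ => A.coeff θ + periodize Real.two_pi_pos (bump y) θ :=
    exists_coeff_eq (A.contDiff_coeff.add ((isCkFamily_periodize 0).1 y))
      (A.coeff_periodic.add (periodic_periodize _ _))
  choose F hF using exists_coeff
  refine ⟨F, continuous_iff.2 fun n => ?_, ext_coeff fun θ => ?_, fun y => ?_⟩
  · simp only [hF]
    exact (IsCkFamily.const A.contDiff_coeff).add (isCkFamily_periodize n)
  · simp only [hF, periodize, bump, coordPathLogDeriv_unitCoord, map_zero, add_zero]
  · refine (hol_eq_of_coeff_eq (S := Ioo (-1) (2 * Real.pi + 1)) isOpen_Ioo isPreconnected_Ioo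
      ⟨by linarith, by linarith⟩ ⟨by linarith, by linarith⟩
      (fun θ _ => hasLeftLogDerivAt_coordPath (coordPath_mem y θ))
      (by rw [coordPath_zero, unitChart_symm_unitCoord]) fun θ hθ => ?_).trans
        (by rw [coordPath_two_pi])
    have periodize_eq := periodize_eq_of_support_subset Real.two_pi_pos (support_bump y)
      zero_le_one two_lt 0 (θ := θ)
      (by simp only [Int.cast_zero]; linarith [hθ.1])
      (by simp only [Int.cast_zero]; linarith [hθ.2])
    simpa only [hF, Int.cast_zero, zero_mul, sub_zero, add_right_inj] using periodize_eq

variable (I G) in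
theorem isOpenMap_hol : IsOpenMap fun A : CircleConnection I G => A.hol := by
  have := topologicalGroup_of_lieGroup I ∞ (G := G)
  refine isOpenMap_iff_nhds_le.2 fun A S hS => ?_
  obtain ⟨r, hr, hball⟩ := Metric.mem_nhds_iff.1 (unitChart_target_mem_nhds I G)
  obtain ⟨F, hF, hFA, hol_eq⟩ :=
    A.exists_deformation (convex_ball _ r) (Metric.mem_ball_self hr) hball
  have deformation_mem : ∀ᶠ y in 𝓝 (unitCoord I G), ∃ hy, (F ⟨y, hy⟩).hol ∈ S := by
    rw [← map_nhds_subtype_coe_eq_nhds (Metric.mem_ball_self hr) (Metric.ball_mem_nhds _ hr),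
      eventually_map]
    exact (hF.continuousAt.eventually (hFA.symm ▸ hS)).mono fun y hy => ⟨y.2, hy⟩
  have div_continuousAt : ContinuousAt (fun x : G => x⁻¹ * A.hol) A.hol := by fun_prop
  have coord_tendsto :
      Tendsto (fun x : G => unitChart I G (x⁻¹ * A.hol)) (𝓝 A.hol) (𝓝 (unitCoord I G)) := by
    refine (tendsto_unitChart I G).comp ?_
    simpa only [ContinuousAt, inv_mul_cancel] using div_continuousAt
  filter_upwards [coord_tendsto.eventually deformation_mem,
    eventually_unitChart_symm_apply I div_continuousAt (inv_mul_cancel _)] with x ⟨hx, hS⟩ symm_eq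
  simpa only [hol_eq, symm_eq, mul_inv_rev, inv_inv, mul_inv_cancel_left] using hS

variable (I G) in
theorem eventually_exists_hol_eq : ∀ᶠ x in 𝓝 (1 : G), ∀ A : CircleConnection I G,
    ∃ B : CircleConnection I G, B.hol = A.hol * x⁻¹ := by
  obtain ⟨r, hr, hball⟩ := Metric.mem_nhds_iff.1 (unitChart_target_mem_nhds I G)
  have coord_mem : ∀ᶠ x in 𝓝 (1 : G), unitChart I G x ∈ Metric.ball (unitCoord I G) r :=
    (tendsto_unitChart I G).eventually (Metric.ball_mem_nhds _ hr)
  filter_upwards [coord_mem, eventually_unitChart_symm_apply (G := G) I continuousAt_id rfl]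
    with x hx symm_eq A
  obtain ⟨F, -, -, hol_eq⟩ :=
    A.exists_deformation (convex_ball _ r) (Metric.mem_ball_self hr) hball
  exact ⟨F ⟨_, hx⟩, (hol_eq _).trans (congrArg (fun z => A.hol * z⁻¹) symm_eq)⟩

variable (I G) in
theorem surjective_hol [ConnectedSpace G] :
    Function.Surjective fun A : CircleConnection I G => A.hol := by
  have := topologicalGroup_of_lieGroup I ∞ (G := G)
  obtain ⟨A₀, -⟩ := exists_coeff_eq (I := I) (G := G) (c := fun _ => 0) contDiff_const
    fun _ => rfl
  have isClosed_range : IsClosed (range fun A : CircleConnection I G => A.hol) := by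
    refine isClosed_of_closure_subset fun x hx => ?_
    have div_continuousAt : ContinuousAt (fun z => x⁻¹ * z) x := by fun_prop
    obtain ⟨_, exists_hol_eq, A, rfl⟩ := mem_closure_iff_nhds.1 hx _
      (div_continuousAt.eventually ((inv_mul_cancel x).symm ▸ eventually_exists_hol_eq I G))
    obtain ⟨B, hB⟩ := exists_hol_eq A
    exact ⟨B, by simpa using hB⟩
  exact range_eq_univ.1 <|
    IsClopen.eq_univ ⟨isClosed_range, (isOpenMap_hol I G).isOpen_range⟩ ⟨_, A₀, rfl⟩

end CircleConnection

section Morita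

variable {E : Type*} [NormedAddCommGroup E] [NormedSpace ℝ E]
  {H : Type*} [TopologicalSpace H] (I : ModelWithCorners ℝ E H)
  (G : Type*) [TopologicalSpace G] [ChartedSpace H G] [Group G] [LieGroup I ∞ G]

theorem isTopological_connectionGroupoid [I.Boundaryless] :
    (connectionGroupoid I G).IsTopological :=
  have := SmoothLoop.isTopologicalGroup I G
  isTopological_rightActionGroupoid _ _ (CircleConnection.continuous_pullback I G)

theorem isTopological_conjugationGroupoid (Γ : Type*) [TopologicalSpace Γ] [Group Γ]
    [IsTopologicalGroup Γ] : (conjugationGroupoid Γ).IsTopological :=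
  isTopological_rightActionGroupoid _ _ (by fun_prop)

theorem isMorita_holonomyHom [CompleteSpace E] [I.Boundaryless] [ConnectedSpace G] :
    (holonomyHom I G).IsMorita :=
  have := topologicalGroup_of_lieGroup I ∞ (G := G)
  SpaceGroupoid.Hom.isMorita_of_isOpenMap (isTopological_conjugationGroupoid G).continuous_t
    (isOpenMap_s_rightActionGroupoid _ _) (CircleConnection.isOpenMap_hol I G)
    (CircleConnection.surjective_hol I G) (isHomeomorph_holonomyHom_toArrowPullback I G)

end Morita

end

theorem mainTheorem11_general {E : Type*} [NormedAddCommGroup E] [NormedSpace ℝ E]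
    [CompleteSpace E] {H : Type*} [TopologicalSpace H] (I : ModelWithCorners ℝ E H)
    [I.Boundaryless] (G : Type*) [TopologicalSpace G] [ChartedSpace H G] [Group G]
    [LieGroup I ∞ G] [ConnectedSpace G] :
    (connectionGroupoid I G).IsTopological ∧
    (conjugationGroupoid G).IsTopological ∧
    SpaceGroupoid.MoritaEquivalent (connectionGroupoid I G) (conjugationGroupoid G) ∧
    ∃ Ψ : SpaceGroupoid.Hom (connectionGroupoid I G) (conjugationGroupoid G),
      (∀ (A : CircleConnection I G) (x : G), A.HasHolonomy x ↔ x = Ψ.obj A) ∧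
      (∀ (A : CircleConnection I G) (g : SmoothLoop I G), Ψ.arr (A, g) = (Ψ.obj A, g 1)) ∧
      Ψ.IsMorita := by
  have := topologicalGroup_of_lieGroup I ∞ (G := G)
  have isTopological := isTopological_connectionGroupoid I G
  have isMorita_id := isTopological.isMorita_id (isOpenMap_s_rightActionGroupoid _ _)
  have isMorita_holonomy := isMorita_holonomyHom I G
  exact ⟨isTopological, isTopological_conjugationGroupoid G,
    ⟨connectionGroupoid I G, .id _, holonomyHom I G, isTopological, isMorita_id, isMorita_holonomy⟩,
    holonomyHom I G, CircleConnection.hasHolonomy_iff, fun _ _ => rfl, isMorita_holonomy⟩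

theorem mainTheorem11 {E : Type*} [NormedAddCommGroup E] [NormedSpace ℝ E] [FiniteDimensional ℝ E]
    {H : Type*} [TopologicalSpace H] (I : ModelWithCorners ℝ E H) [I.Boundaryless]
    (G : Type*) [TopologicalSpace G] [ChartedSpace H G] [Group G] [LieGroup I ∞ G]
    [T2Space G] [ConnectedSpace G] :
    (connectionGroupoid I G).IsTopological ∧
    (conjugationGroupoid G).IsTopological ∧
    SpaceGroupoid.MoritaEquivalent (connectionGroupoid I G) (conjugationGroupoid G) ∧
    ∃ Ψ : SpaceGroupoid.Hom (connectionGroupoid I G) (conjugationGroupoid G),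
      (∀ (A : CircleConnection I G) (x : G), A.HasHolonomy x ↔ x = Ψ.obj A) ∧
      (∀ (A : CircleConnection I G) (g : SmoothLoop I G), Ψ.arr (A, g) = (Ψ.obj A, g 1)) ∧
      Ψ.IsMorita :=
  have := FiniteDimensional.complete ℝ E
  mainTheorem11_general I G
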